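/- **Theorem.** The 2-category $\mathbf{D}$ of 2-categories with a strong duality involution, duality 2-functors and duality 2-natural transformations is 2-equivalent to the 2-category $\mathbf{C}$ of 2-categories with contravariance in which every object has a strict opposite, 2-functors preserving contravariance, and 2-natural transformations respecting contravariance. That is, there are strict 2-functors $\mathbf{D}\to\mathbf{C}$ and $\mathbf{C}\to\mathbf{D}$ whose two composites are strictly 2-naturally isomorphic to the identity 2-functors. Here all 2-categories, 2-functors and 2-natural transformations are strict, and $\mathcal{A}^{\mathrm{co}}$ denotes $\mathcal{A}$ with its 2-cells reversed. *The 2-category* $\mathbf{D}$. - A *strong duality involution* on a 2-category $\mathcal{A}$ consists of a 2-functor $(-)^\circ:\mathcal{A}^{\mathrm{co}}\to\mathcal{A}$ and a 2-natural isomorphism $\mathfrak{y}_x: x\to x^{\circ\circ}$ from $1_{\mathcal A}$ to $(-)^\circ\circ((-)^{\circ})^{\mathrm{co}}$, such that $\mathfrak{y}_{x^\circ}=(\mathfrak{y}_x)^\circ$ for every object $x$. - A *duality 2-functor* $\mathcal{A}\to\mathcal{B}$ is a 2-functor $F$ with a 2-natural isomorphism $\mathfrak{i}_x:(Fx)^\circ\to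 F(x^\circ)$ from $(-)^\circ\circ F^{\mathrm{co}}$ to $F\circ(-)^\circ$, such that $\mathfrak{i}_{x^\circ}\circ(\mathfrak{i}_x)^\circ\circ\mathfrak{y}_{Fx}=F(\mathfrak{y}_x)$ for every $x$. The composite of $F$ and $G$ has structure isomorphism $G(\mathfrak{i}^F_x)\circ\mathfrak{i}^G_{Fx}$. - A *duality 2-natural transformation* $\alpha:F\to G$ is a 2-natural transformation with $\alpha_{x^\circ}\circ\mathfrak{i}^F_x=\mathfrak{i}^G_x\circ(\alpha_x)^\circ$ for every $x$. *The 2-category* $\mathbf{C}$. - A *2-category with contravariance* $\mathcal{A}$ consists of a collection of objects; for all objects $x,y$, categories $\mathcal{A}^+(x,y)$ and $\mathcal{A}^-(x,y)$ of covariant and contravariant morphisms; identities $1_x\in\mathcal{A}^+(x,x)$; and composition functors $$\mathcal{A}^+(y,z)\times\mathcal{A}^+(x,y)\to\mathcal{A}^+(x,z),\qquad \mathcal{A}^-(y,z)\times\mathcal{A}^-(x,y)^{\mathrm{op}}\to\mathcal{A}^+(x,z),$$ $$\mathcal{A}^+(y,z)\times\mathcal{A}^-(x,y)\to\mathcal{A}^-(x,z),\qquad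 \mathcal{A}^-(y,z)\times\mathcal{A}^+(x,y)^{\mathrm{op}}\to\mathcal{A}^-(x,z),$$ which are strictly unital and associative (four unit laws and eight associativity laws, one for each choice of variances). - A *strict opposite* of an object $x$ is an object $x^\circ$ with some $\chi_x\in\mathcal{A}^-(x,x^\circ)$ such that, for every object $y$, precomposition with $\chi_x$ gives isomorphisms of categories $\mathcal{A}^+(x^\circ,y)\cong\mathcal{A}^-(x,y)$ and $\mathcal{A}^-(x^\circ,y)\cong\mathcal{A}^+(x,y)$. - A *2-functor preserving contravariance* $F:\mathcal A\to\mathcal B$ consists of a map on objects and functors $\mathcal{A}^{\pm}(x,y)\to\mathcal{B}^{\pm}(Fx,Fy)$ that strictly preserve identities and all four kinds of composition. - A *2-natural transformation respecting contravariance* $\alpha: F\to G$ consists of covariant morphisms $\alpha_x\in\mathcal{B}^+(Fx,Gx)$ such that $\alpha_y\circ F(-)=G(-)\circ\alpha_x$ as functors $\mathcal{A}^+(x,y)\to\mathcal{B}^+(Fx,Gy)$ and as functors $\mathcal{A}^-(x,y)\to\mathcal{B}^-(Fx,Gy)$. -/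

import Mathlib

universe w v u

open CategoryTheory Bicategory Opposite

namespace TwoDuality

universe w₁ v₁ u₁ w₂ v₂ u₂ w₃ v₃ u₃ w₄ v₄ u₄

/-! ### Strict 2-functors and strict 2-natural transformations

A (strict) 2-category is a `Bicategory` with `Bicategory.Strict`, and a (strict) 2-functor is a
`StrictPseudofunctor`. -/

section StrictTwoCategories

attribute [local simp] Strict.leftUnitor_eqToIso Strict.rightUnitor_eqToIso
  Strict.associator_eqToIso

variable {B : Type u₁} [Bicategory.{w₁, v₁} B] {C : Type u₂} [Bicategory.{w₂, v₂} C]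
  {D : Type u₃} [Bicategory.{w₃, v₃} D]

theorem strictPseudofunctor_ext {F G : StrictPseudofunctor B C}
    (h : F.toPrelaxFunctor = G.toPrelaxFunctor) : F = G := by
  obtain ⟨⟨⟨F, i, c, _, _, _, _, _⟩, _, hi⟩, _, hc⟩ := F
  obtain ⟨⟨⟨G, j, d, _, _, _, _, _⟩, _, hj⟩, _, hd⟩ := G
  obtain rfl : F = G := h
  obtain rfl : i = j := by
    funext x
    exact (hi x).trans (hj x).symm
  obtain rfl : @c = @d := by
    funext x y z f g
    exact (hc f g).trans (hd f g).symm
  rfl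

theorem map₂_whiskerLeft_strict (F : StrictPseudofunctor B C) {a b c : B} (f : a ⟶ b)
    {g g' : b ⟶ c} (η : g ⟶ g') :
    F.map₂ (f ◁ η) = eqToHom (F.map_comp f g) ≫ F.map f ◁ F.map₂ η ≫
      eqToHom (F.map_comp f g').symm := by
  simp [StrictPseudofunctor.mapComp_eq_eqToIso]

theorem map₂_whiskerRight_strict (F : StrictPseudofunctor B C) {a b c : B} {f f' : a ⟶ b}
    (η : f ⟶ f') (g : b ⟶ c) :
    F.map₂ (η ▷ g) = eqToHom (F.map_comp f g) ≫ F.map₂ η ▷ F.map g ≫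
      eqToHom (F.map_comp f' g).symm := by
  simp [StrictPseudofunctor.mapComp_eq_eqToIso]

/-- A strict 2-natural transformation between strict 2-functors. -/
structure TwoNatTrans (F G : StrictPseudofunctor B C) where
  app (a : B) : F.obj a ⟶ G.obj a
  naturality {a b : B} (f : a ⟶ b) : F.map f ≫ app b = app a ≫ G.map f
  naturality₂ {a b : B} {f g : a ⟶ b} (η : f ⟶ g) :
    F.map₂ η ▷ app b =
      eqToHom (naturality f) ≫ app a ◁ G.map₂ η ≫ eqToHom (naturality g).symm

namespace TwoNatTrans

theorem ext {F G : StrictPseudofunctor B C} {α β : TwoNatTrans F G}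
    (h : ∀ a, α.app a = β.app a) : α = β := by
  obtain ⟨a, _, _⟩ := α
  obtain ⟨b, _, _⟩ := β
  obtain rfl : a = b := funext h
  rfl

variable [Strict B] [Strict C] [Strict D]

/-- The identity 2-natural transformation. -/
def id (F : StrictPseudofunctor B C) : TwoNatTrans F F where
  app a := 𝟙 (F.obj a)
  naturality f := (Strict.comp_id _).trans (Strict.id_comp _).symm
  naturality₂ η := by simp

/-- Vertical composition. -/
def vcomp {F G H : StrictPseudofunctor B C} (α : TwoNatTrans F G) (β : TwoNatTrans G H) :
    TwoNatTrans F H where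
  app a := α.app a ≫ β.app a
  naturality f := by
    rw [← Strict.assoc, α.naturality, Strict.assoc, β.naturality, Strict.assoc]
  naturality₂ η := by
    simp [α.naturality₂, β.naturality₂]

/-- Whiskering by a 2-functor on the source side. -/
def whiskerLeft (F : StrictPseudofunctor B C) {G H : StrictPseudofunctor C D}
    (α : TwoNatTrans G H) : TwoNatTrans (F.comp G) (F.comp H) where
  app a := α.app (F.obj a)
  naturality f := α.naturality (F.map f)
  naturality₂ η := α.naturality₂ (F.map₂ η)

/-- Whiskering by a 2-functor on the target side. -/
def whiskerRight {F G : StrictPseudofunctor B C} (α : TwoNatTrans F G)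
    (H : StrictPseudofunctor C D) : TwoNatTrans (F.comp H) (G.comp H) where
  app a := H.map (α.app a)
  naturality f := by
    change H.map (F.map f) ≫ _ = _ ≫ H.map (G.map f)
    rw [← H.map_comp, α.naturality, H.map_comp]
  naturality₂ {a b f g} η := by
    have h := congrArg H.map₂ (α.naturality₂ η)
    rw [PrelaxFunctor.map₂_comp, PrelaxFunctor.map₂_comp, map₂_whiskerRight_strict,
      map₂_whiskerLeft_strict, PrelaxFunctor.map₂_eqToHom, PrelaxFunctor.map₂_eqToHom] at h
    change H.map₂ (F.map₂ η) ▷ _ = _ ≫ _ ◁ H.map₂ (G.map₂ η) ≫ _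
    rw [eqToHom_comp_iff, comp_eqToHom_iff] at h
    rw [h]
    simp
    rfl

/-- Reassociation of the source. -/
def assocSource {E : Type u₄} [Bicategory.{w₄, v₄} E] {F : StrictPseudofunctor B C}
    {G : StrictPseudofunctor C D} {H : StrictPseudofunctor D E} {K : StrictPseudofunctor B E}
    (α : TwoNatTrans ((F.comp G).comp H) K) : TwoNatTrans (F.comp (G.comp H)) K where
  app a := α.app a
  naturality f := α.naturality f
  naturality₂ η := α.naturality₂ η

end TwoNatTrans

/-- The components of a 2-natural transformation, along with componentwise inverses, give
a 2-natural inverse. -/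
theorem TwoNatTrans.exists_inv [Strict B] [Strict C] {F G : StrictPseudofunctor B C}
    (α : TwoNatTrans F G) (h : ∀ a, ∃ g : G.obj a ⟶ F.obj a, α.app a ≫ g = 𝟙 _ ∧
      g ≫ α.app a = 𝟙 _) :
    ∃ β : TwoNatTrans G F,
      α.vcomp β = TwoNatTrans.id F ∧ β.vcomp α = TwoNatTrans.id G := by
  choose g h₁ h₂ using h
  have hR : ∀ {x y z : C} {f f' : x ⟶ y} (η : f ⟶ f') {p : y ⟶ z} {q : z ⟶ y}
      (e : p ≫ q = 𝟙 y), HEq ((η ▷ p) ▷ q) η := by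
    intro x y z f f' η p q e
    have : HEq (η ▷ (p ≫ q)) η := by
      rw [e]
      simp
    refine HEq.trans ?_ this
    simp
  have hL : ∀ {x y z : C} {f f' : y ⟶ z} (η : f ⟶ f') {p : x ⟶ y} {q : y ⟶ x}
      (e : q ≫ p = 𝟙 y), HEq (q ◁ p ◁ η) η := by
    intro x y z f f' η p q e
    have : HEq ((q ≫ p) ◁ η) η := by
      rw [e]
      simp
    refine HEq.trans ?_ this
    simp
  have nat : ∀ {a b : B} (f : a ⟶ b), G.map f ≫ g b = g a ≫ F.map f := by
    intro a b f
    calc G.map f ≫ g b = (g a ≫ α.app a) ≫ G.map f ≫ g b := by rw [h₂, Strict.id_comp]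
      _ = g a ≫ (α.app a ≫ G.map f) ≫ g b := by simp only [Strict.assoc]
      _ = g a ≫ F.map f ≫ α.app b ≫ g b := by rw [← α.naturality, Strict.assoc]
      _ = g a ≫ F.map f := by rw [h₁, Strict.comp_id]
  refine ⟨⟨g, nat, ?_⟩, TwoNatTrans.ext h₁, TwoNatTrans.ext h₂⟩
  intro a b f f' η
  have key := congrArg (fun θ => g a ◁ (θ ▷ g b)) (α.naturality₂ η)
  have e₁ : HEq (g a ◁ (F.map₂ η ▷ α.app b ▷ g b)) (g a ◁ F.map₂ η) := by
    have hf : ∀ f : a ⟶ b, (F.map f ≫ α.app b) ≫ g b = F.map f := fun f => by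
      rw [Strict.assoc, h₁, Strict.comp_id]
    have := hR (F.map₂ η) (h₁ b)
    revert this
    generalize F.map₂ η ▷ α.app b ▷ g b = θ
    revert θ
    rw [hf, hf]
    intro θ hθ
    rw [eq_of_heq hθ]
  have e₂ : HEq (g a ◁ ((eqToHom (α.naturality f) ≫ α.app a ◁ G.map₂ η ≫
      eqToHom (α.naturality f').symm) ▷ g b)) (G.map₂ η ▷ g b) := by
    refine HEq.trans ?_ (hL (G.map₂ η ▷ g b) (h₂ a))
    simp
  rw [← heq_iff_eq, heq_eqToHom_comp_iff, heq_comp_eqToHom_iff]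
  exact e₂.symm.trans ((heq_of_eq key.symm).trans e₁)

/-- A strict 2-natural isomorphism: a 2-natural transformation with a 2-natural inverse. -/
structure TwoNatIso [Strict B] [Strict C] (F G : StrictPseudofunctor B C) extends
    TwoNatTrans F G where
  exists_inv : ∃ β : TwoNatTrans G F,
    toTwoNatTrans.vcomp β = TwoNatTrans.id F ∧ β.vcomp toTwoNatTrans = TwoNatTrans.id G

namespace TwoNatIso

variable [Strict B] [Strict C] [Strict D]

theorem ext {F G : StrictPseudofunctor B C} {α β : TwoNatIso F G}
    (h : ∀ a, α.app a = β.app a) : α = β := by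
  obtain ⟨a, _⟩ := α
  obtain ⟨b, _⟩ := β
  obtain rfl : a = b := TwoNatTrans.ext h
  rfl

theorem exists_app_inv {F G : StrictPseudofunctor B C} (α : TwoNatIso F G) (a : B) :
    ∃ g : G.obj a ⟶ F.obj a, α.app a ≫ g = 𝟙 _ ∧ g ≫ α.app a = 𝟙 _ := by
  obtain ⟨β, h₁, h₂⟩ := α.exists_inv
  exact ⟨β.app a, congrArg (fun θ => TwoNatTrans.app θ a) h₁,
    congrArg (fun θ => TwoNatTrans.app θ a) h₂⟩

end TwoNatIso

theorem conj_id {B : Type u} [Bicategory.{w, v} B] [Strict B] {x y : B} {p : x ⟶ x}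
    {q : y ⟶ y} (hp : p = 𝟙 x) (hq : q = 𝟙 y) (f : x ⟶ y) : p ≫ f ≫ q = f := by
  rw [hp, hq, Strict.id_comp, Strict.comp_id]

theorem comp_inv {B : Type u} [Bicategory.{w, v} B] [Strict B] {x y z : B} {p : x ⟶ y} {p' : y ⟶ x} {q : y ⟶ z} {q' : z ⟶ y}
    (h₁ : p ≫ p' = 𝟙 x) (h₂ : p' ≫ p = 𝟙 y) (h₃ : q ≫ q' = 𝟙 y) (h₄ : q' ≫ q = 𝟙 z) :
    ∃ r : z ⟶ x, (p ≫ q) ≫ r = 𝟙 x ∧ r ≫ p ≫ q = 𝟙 z := by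
  refine ⟨q' ≫ p', ?_, ?_⟩
  · rw [Strict.assoc, ← Strict.assoc q, h₃, Strict.id_comp, h₁]
  · rw [Strict.assoc, ← Strict.assoc p', h₂, Strict.id_comp, h₄]

/-- A 2-equivalence between 2-categories: a pair of 2-functors that are mutually inverse up to
2-natural isomorphisms. -/
structure TwoEquivalence (B : Type u₁) [Bicategory.{w₁, v₁} B] [Strict B]
    (C : Type u₂) [Bicategory.{w₂, v₂} C] [Strict C] where
  functor : StrictPseudofunctor B C
  inverse : StrictPseudofunctor C B
  unitIso : TwoNatIso (StrictPseudofunctor.id B) (functor.comp inverse)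
  counitIso : TwoNatIso (inverse.comp functor) (StrictPseudofunctor.id C)

/-- The 2-category `Bᶜᵒ`: the same objects and 1-cells as `B`, with all 2-cells reversed. -/
structure Co (B : Type u) where
  unco : B

namespace Co

instance : Bicategory.{w₁, v₁} (Co B) where
  Hom x y := (x.unco ⟶ y.unco)ᵒᵖ
  id x := op (𝟙 x.unco)
  comp f g := op (f.unop ≫ g.unop)
  homCategory x y := inferInstanceAs (Category (x.unco ⟶ y.unco)ᵒᵖ)
  whiskerLeft f _ _ η := (f.unop ◁ η.unop).op
  whiskerRight η h := (η.unop ▷ h.unop).op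
  associator f g h := (α_ f.unop g.unop h.unop).symm.op
  leftUnitor f := (λ_ f.unop).symm.op
  rightUnitor f := (ρ_ f.unop).symm.op
  whiskerLeft_id f g := Quiver.Hom.unop_inj (by simp)
  whiskerLeft_comp f _ _ _ η θ := Quiver.Hom.unop_inj (by simp)
  id_whiskerLeft η := Quiver.Hom.unop_inj (by simp)
  comp_whiskerLeft f g _ _ η := Quiver.Hom.unop_inj (by simp)
  id_whiskerRight f g := Quiver.Hom.unop_inj (by simp)
  comp_whiskerRight η θ i := Quiver.Hom.unop_inj (by simp)
  whiskerRight_id η := Quiver.Hom.unop_inj (by simp)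
  whiskerRight_comp η g h := Quiver.Hom.unop_inj (by simp)
  whisker_assoc f _ _ η h := Quiver.Hom.unop_inj (by simp)
  whisker_exchange η θ := Quiver.Hom.unop_inj (whisker_exchange _ _).symm
  pentagon f g h i := Quiver.Hom.unop_inj (by simp)
  triangle f g := Quiver.Hom.unop_inj (by simp)

/-- The 1-cell of `B` underlying a 1-cell of `Bᶜᵒ`. -/
abbrev un {x y : Co B} (f : x ⟶ y) : x.unco ⟶ y.unco := Opposite.unop f

/-- A 1-cell of `B` regarded as a 1-cell of `Bᶜᵒ`. -/
abbrev mk₁ {x y : B} (f : x ⟶ y) : Co.mk x ⟶ Co.mk y := Opposite.op f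

/-- The 2-cell of `B` underlying a 2-cell of `Bᶜᵒ`, in the reverse direction. -/
abbrev un₂ {x y : Co B} {f g : x ⟶ y} (η : f ⟶ g) : un g ⟶ un f := Quiver.Hom.unop η

/-- A 2-cell of `B` regarded as a 2-cell of `Bᶜᵒ`, in the reverse direction. -/
abbrev mk₂ {x y : B} {f g : x ⟶ y} (η : f ⟶ g) : mk₁ g ⟶ mk₁ f := Quiver.Hom.op η

theorem un₂_eqToHom {x y : Co B} {f g : x ⟶ y} (h : f = g) :
    un₂ (eqToHom h) = eqToHom (congrArg un h.symm) := by
  subst h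
  rfl

theorem mk₂_eqToHom {x y : B} {f g : x ⟶ y} (h : f = g) :
    mk₂ (eqToHom h) = eqToHom (congrArg mk₁ h.symm) := by
  subst h
  rfl

theorem hom₂_ext {x y : Co B} {f g : x ⟶ y} {η θ : f ⟶ g} (h : un₂ η = un₂ θ) : η = θ :=
  Quiver.Hom.unop_inj h

instance [Strict B] : Strict (Co B) where
  id_comp f := congrArg op (Strict.id_comp (un f))
  comp_id f := congrArg op (Strict.comp_id (un f))
  assoc f g h := congrArg op (Strict.assoc (un f) (un g) (un h))
  leftUnitor_eqToIso f := by
    ext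
    apply hom₂_ext
    rw [eqToIso.hom, un₂_eqToHom]
    exact congrArg Iso.inv (Strict.leftUnitor_eqToIso (un f))
  rightUnitor_eqToIso f := by
    ext
    apply hom₂_ext
    rw [eqToIso.hom, un₂_eqToHom]
    exact congrArg Iso.inv (Strict.rightUnitor_eqToIso (un f))
  associator_eqToIso f g h := by
    ext
    apply hom₂_ext
    rw [eqToIso.hom, un₂_eqToHom]
    exact congrArg Iso.inv (Strict.associator_eqToIso (un f) (un g) (un h))

end Co

variable [Strict B] [Strict C] [Strict D]

/-- The 2-functor `Fᶜᵒ : Bᶜᵒ → Cᶜᵒ` induced by `F : B → C`. -/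
def coFunctor (F : StrictPseudofunctor B C) : StrictPseudofunctor (Co B) (Co C) :=
  StrictPseudofunctor.mk''
    { obj := fun x => ⟨F.obj x.unco⟩
      map := fun f => Co.mk₁ (F.map (Co.un f))
      map₂ := fun η => Co.mk₂ (F.map₂ (Co.un₂ η))
      map₂_id := fun f => congrArg Co.mk₂ (F.map₂_id (Co.un f))
      map₂_comp := fun η θ => congrArg Co.mk₂ (F.map₂_comp (Co.un₂ θ) (Co.un₂ η))
      map_id := fun x => congrArg Co.mk₁ (F.map_id x.unco)
      map_comp := fun f g => congrArg Co.mk₁ (F.map_comp (Co.un f) (Co.un g))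
      map₂_whisker_left := fun f _ _ η => by
        refine (congrArg Co.mk₂ (map₂_whiskerLeft_strict F (Co.un f) (Co.un₂ η))).trans ?_
        apply Co.hom₂_ext
        change _ = (Co.un₂ (eqToHom _) ≫ _) ≫ Co.un₂ (eqToHom _)
        rw [Co.un₂_eqToHom, Co.un₂_eqToHom, Category.assoc]
        rfl
      map₂_whisker_right := fun η g => by
        refine (congrArg Co.mk₂ (map₂_whiskerRight_strict F (Co.un₂ η) (Co.un g))).trans ?_
        apply Co.hom₂_ext
        change _ = (Co.un₂ (eqToHom _) ≫ _) ≫ Co.un₂ (eqToHom _)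
        rw [Co.un₂_eqToHom, Co.un₂_eqToHom, Category.assoc]
        rfl }

/-- The 2-functor `Gᶜᵒ : B → Cᶜᵒ` induced by `G : Bᶜᵒ → C`. -/
def coTranspose (G : StrictPseudofunctor (Co B) C) : StrictPseudofunctor B (Co C) :=
  StrictPseudofunctor.mk''
    { obj := fun x => ⟨G.obj ⟨x⟩⟩
      map := fun f => Co.mk₁ (G.map (Co.mk₁ f))
      map₂ := fun η => Co.mk₂ (G.map₂ (Co.mk₂ η))
      map₂_id := fun f => congrArg Co.mk₂ (G.map₂_id (Co.mk₁ f))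
      map₂_comp := fun η θ => congrArg Co.mk₂ (G.map₂_comp (Co.mk₂ θ) (Co.mk₂ η))
      map_id := fun x => congrArg Co.mk₁ (G.map_id ⟨x⟩)
      map_comp := fun f g => congrArg Co.mk₁ (G.map_comp (Co.mk₁ f) (Co.mk₁ g))
      map₂_whisker_left := fun f _ _ η => by
        refine (congrArg Co.mk₂ (map₂_whiskerLeft_strict G (Co.mk₁ f) (Co.mk₂ η))).trans ?_
        apply Co.hom₂_ext
        change _ = (Co.un₂ (eqToHom _) ≫ _) ≫ Co.un₂ (eqToHom _)
        rw [Co.un₂_eqToHom, Co.un₂_eqToHom, Category.assoc]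
        rfl
      map₂_whisker_right := fun η g => by
        refine (congrArg Co.mk₂ (map₂_whiskerRight_strict G (Co.mk₂ η) (Co.mk₁ g))).trans ?_
        apply Co.hom₂_ext
        change _ = (Co.un₂ (eqToHom _) ≫ _) ≫ Co.un₂ (eqToHom _)
        rw [Co.un₂_eqToHom, Co.un₂_eqToHom, Category.assoc]
        rfl }

end StrictTwoCategories

/-! ### 2-categories with a strong duality involution -/

section DualityInvolutions

/-- A strong duality involution on a 2-category `A`: a strict 2-functor `(-)° : Aᶜᵒ → A`, a
strict 2-natural isomorphism `y` from the identity to `A → Aᶜᵒ → A`, and the equality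
`y_{x°} = (y_x)°`. -/
structure StrongDualityInvolution (A : Type u) [Bicategory.{w, v} A] [Strict A] where
  dual : StrictPseudofunctor (Co A) A
  y : TwoNatIso (StrictPseudofunctor.id A) ((coTranspose dual).comp dual)
  zeta (x : A) : y.app (dual.obj ⟨x⟩) = dual.map (Co.mk₁ (y.app x))

namespace StrongDualityInvolution

variable {A : Type u} [Bicategory.{w, v} A] [Strict A] (S : StrongDualityInvolution A)

/-- The object `x°`. -/
def dObj (x : A) : A := S.dual.obj ⟨x⟩

/-- The 1-cell `f° : x° ⟶ y°`. -/
def dMap {x y : A} (f : x ⟶ y) : S.dObj x ⟶ S.dObj y := S.dual.map (Co.mk₁ f)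

/-- The 1-cell `y_x : x ⟶ x°°`. -/
def yApp (x : A) : x ⟶ S.dObj (S.dObj x) := S.y.app x

theorem dMap_id (x : A) : S.dMap (𝟙 x) = 𝟙 (S.dObj x) := S.dual.map_id ⟨x⟩

theorem dMap_comp {x y z : A} (f : x ⟶ y) (g : y ⟶ z) :
    S.dMap (f ≫ g) = S.dMap f ≫ S.dMap g := S.dual.map_comp (Co.mk₁ f) (Co.mk₁ g)

end StrongDualityInvolution

set_option linter.checkUnivs false in
/-- A 2-category equipped with a strong duality involution. -/
structure DualityTwoCat where
  carrier : Type u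
  [bicategory : Bicategory.{w, v} carrier]
  [strict : Strict carrier]
  inv : StrongDualityInvolution carrier

attribute [instance] DualityTwoCat.bicategory DualityTwoCat.strict

/-- A (strong) duality 2-functor: a strict 2-functor `F`, a strict 2-natural isomorphism
`i_x : (F x)° → F (x°)`, and the equality `i_{x°} ∘ (i_x)° ∘ y_{F x} = F (y_x)`. -/
structure DualityFunctor (A B : DualityTwoCat.{w, v, u}) where
  toFunctor : StrictPseudofunctor A.carrier B.carrier
  i : TwoNatIso ((coFunctor toFunctor).comp B.inv.dual) (A.inv.dual.comp toFunctor)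
  theta (x : A.carrier) :
    B.inv.y.app (toFunctor.obj x) ≫ B.inv.dual.map (Co.mk₁ (i.app ⟨x⟩)) ≫
      i.app ⟨A.inv.dual.obj ⟨x⟩⟩ = toFunctor.map (A.inv.y.app x)

/-- A duality 2-natural transformation: a strict 2-natural transformation compatible with the
structure isomorphisms `i`. -/
structure DualityNatTrans {A B : DualityTwoCat.{w, v, u}} (F G : DualityFunctor A B) extends
    TwoNatTrans F.toFunctor G.toFunctor where
  compat (x : A.carrier) :
    F.i.app ⟨x⟩ ≫ app (A.inv.dual.obj ⟨x⟩) = B.inv.dual.map (Co.mk₁ (app x)) ≫ G.i.app ⟨x⟩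


/-- The 1-cell `i_x : (F x)° ⟶ F (x°)`. -/
def DualityFunctor.iApp {A B : DualityTwoCat.{w, v, u}} (F : DualityFunctor A B)
    (x : A.carrier) :
    B.inv.dObj (F.toFunctor.obj x) ⟶ F.toFunctor.obj (A.inv.dObj x) := F.i.app ⟨x⟩

theorem DualityFunctor.iApp_naturality {A B : DualityTwoCat.{w, v, u}} (F : DualityFunctor A B)
    {x y : A.carrier} (f : x ⟶ y) :
    B.inv.dMap (F.toFunctor.map f) ≫ F.iApp y = F.iApp x ≫ F.toFunctor.map (A.inv.dMap f) :=
  F.i.naturality (Co.mk₁ f)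

theorem DualityFunctor.theta' {A B : DualityTwoCat.{w, v, u}} (F : DualityFunctor A B)
    (x : A.carrier) :
    B.inv.yApp (F.toFunctor.obj x) ≫ B.inv.dMap (F.iApp x) ≫ F.iApp (A.inv.dObj x) =
      F.toFunctor.map (A.inv.yApp x) := F.theta x

theorem DualityNatTrans.compat' {A B : DualityTwoCat.{w, v, u}} {F G : DualityFunctor A B}
    (α : DualityNatTrans F G) (x : A.carrier) :
    F.iApp x ≫ α.app (A.inv.dObj x) = B.inv.dMap (α.app x) ≫ G.iApp x := α.compat x

theorem DualityNatTrans.ext {A B : DualityTwoCat.{w, v, u}} {F G : DualityFunctor A B}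
    {α β : DualityNatTrans F G} (h : ∀ x, α.app x = β.app x) : α = β := by
  obtain ⟨a, _⟩ := α
  obtain ⟨b, _⟩ := β
  obtain rfl : a = b := TwoNatTrans.ext h
  rfl

theorem DualityFunctor.ext {A B : DualityTwoCat.{w, v, u}} {F G : DualityFunctor A B}
    (h : F.toFunctor = G.toFunctor) (hi : ∀ x, HEq (F.i.app x) (G.i.app x)) : F = G := by
  obtain ⟨F, i, _⟩ := F
  obtain ⟨G, j, _⟩ := G
  obtain rfl : F = G := h
  obtain rfl : i = j := TwoNatIso.ext fun x => eq_of_heq (hi x)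
  rfl

namespace DualityTwoCat

variable {A B C D : DualityTwoCat.{w, v, u}}

/-- The identity duality 2-functor. -/
def idFunctor (A : DualityTwoCat.{w, v, u}) : DualityFunctor A A where
  toFunctor := StrictPseudofunctor.id A.carrier
  i :=
    { app := fun x => 𝟙 (A.inv.dual.obj x)
      naturality := fun f => (TwoNatTrans.id A.inv.dual).naturality f
      naturality₂ := fun η => (TwoNatTrans.id A.inv.dual).naturality₂ η
      exists_inv := TwoNatTrans.exists_inv _ fun a =>
        ⟨𝟙 (A.inv.dual.obj a), Strict.id_comp (𝟙 (A.inv.dual.obj a)),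
          Strict.id_comp (𝟙 (A.inv.dual.obj a))⟩ }
  theta x := by
    change A.inv.yApp x ≫ A.inv.dMap (𝟙 (A.inv.dObj x)) ≫ 𝟙 (A.inv.dObj (A.inv.dObj x)) =
      A.inv.yApp x
    rw [A.inv.dMap_id, Strict.id_comp, Strict.comp_id]

/-- Composition of duality 2-functors. -/
def compFunctor (F : DualityFunctor A B) (G : DualityFunctor B C) : DualityFunctor A C where
  toFunctor := F.toFunctor.comp G.toFunctor
  i :=
    { app := fun x => G.i.app ⟨F.toFunctor.obj x.unco⟩ ≫ G.toFunctor.map (F.i.app x)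
      naturality := fun f => (TwoNatTrans.vcomp
        (TwoNatTrans.whiskerLeft (coFunctor F.toFunctor) G.i.toTwoNatTrans)
        (TwoNatTrans.assocSource
          (TwoNatTrans.whiskerRight F.i.toTwoNatTrans G.toFunctor))).naturality f
      naturality₂ := fun η => (TwoNatTrans.vcomp
        (TwoNatTrans.whiskerLeft (coFunctor F.toFunctor) G.i.toTwoNatTrans)
        (TwoNatTrans.assocSource
          (TwoNatTrans.whiskerRight F.i.toTwoNatTrans G.toFunctor))).naturality₂ η
      exists_inv := TwoNatTrans.exists_inv _ fun a => by
        obtain ⟨g, h₁, h₂⟩ := F.i.exists_app_inv a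
        obtain ⟨k, h₃, h₄⟩ := G.i.exists_app_inv ⟨F.toFunctor.obj a.unco⟩
        exact comp_inv h₃ h₄ ((G.toFunctor.map_comp _ _).symm.trans
            ((congrArg G.toFunctor.map h₁).trans (G.toFunctor.map_id _)))
          ((G.toFunctor.map_comp _ _).symm.trans
            ((congrArg G.toFunctor.map h₂).trans (G.toFunctor.map_id _))) }
  theta x := by
    have h₁ := F.theta' x
    have h₂ := G.theta' (F.toFunctor.obj x)
    have h₃ := G.iApp_naturality (F.iApp x)
    change C.inv.yApp (G.toFunctor.obj (F.toFunctor.obj x)) ≫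
      C.inv.dMap (G.iApp (F.toFunctor.obj x) ≫ G.toFunctor.map (F.iApp x)) ≫
      G.iApp (F.toFunctor.obj (A.inv.dObj x)) ≫ G.toFunctor.map (F.iApp (A.inv.dObj x)) =
      G.toFunctor.map (F.toFunctor.map (A.inv.yApp x))
    rw [← h₁, G.toFunctor.map_comp, G.toFunctor.map_comp, ← h₂, C.inv.dMap_comp]
    simp only [Strict.assoc]
    rw [← Strict.assoc (C.inv.dMap (G.toFunctor.map _)), h₃, Strict.assoc]

/-- The identity duality 2-natural transformation. -/
def idTrans (F : DualityFunctor A B) : DualityNatTrans F F where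
  toTwoNatTrans := TwoNatTrans.id F.toFunctor
  compat x := by
    change F.iApp x ≫ 𝟙 (F.toFunctor.obj (A.inv.dObj x)) =
      B.inv.dMap (𝟙 (F.toFunctor.obj x)) ≫ F.iApp x
    rw [B.inv.dMap_id, Strict.comp_id, Strict.id_comp]

/-- Vertical composition of duality 2-natural transformations. -/
def vcompTrans {F G H : DualityFunctor A B} (α : DualityNatTrans F G)
    (β : DualityNatTrans G H) : DualityNatTrans F H where
  toTwoNatTrans := α.toTwoNatTrans.vcomp β.toTwoNatTrans
  compat x := by
    change F.iApp x ≫ α.app (A.inv.dObj x) ≫ β.app (A.inv.dObj x) =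
      B.inv.dMap (α.app x ≫ β.app x) ≫ H.iApp x
    rw [B.inv.dMap_comp, Strict.assoc, ← β.compat', ← Strict.assoc, α.compat', Strict.assoc]

instance homCategory (A B : DualityTwoCat.{w, v, u}) : Category (DualityFunctor A B) where
  Hom F G := DualityNatTrans F G
  id F := idTrans F
  comp α β := vcompTrans α β
  id_comp _ := DualityNatTrans.ext fun _ => Strict.id_comp _
  comp_id _ := DualityNatTrans.ext fun _ => Strict.comp_id _
  assoc _ _ _ := DualityNatTrans.ext fun _ => Strict.assoc _ _ _

/-- Whiskering by a duality 2-functor on the source side. -/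
def whiskerLeftTrans (F : DualityFunctor A B) {G H : DualityFunctor B C}
    (α : DualityNatTrans G H) : DualityNatTrans (compFunctor F G) (compFunctor F H) where
  toTwoNatTrans := TwoNatTrans.whiskerLeft F.toFunctor α.toTwoNatTrans
  compat x := by
    change (G.iApp (F.toFunctor.obj x) ≫ G.toFunctor.map (F.iApp x)) ≫
      α.app (F.toFunctor.obj (A.inv.dObj x)) =
      C.inv.dMap (α.app (F.toFunctor.obj x)) ≫
        H.iApp (F.toFunctor.obj x) ≫ H.toFunctor.map (F.iApp x)
    rw [Strict.assoc, α.naturality (F.iApp x), ← Strict.assoc, α.compat', Strict.assoc]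

/-- Whiskering by a duality 2-functor on the target side. -/
def whiskerRightTrans {F G : DualityFunctor A B} (α : DualityNatTrans F G)
    (H : DualityFunctor B C) : DualityNatTrans (compFunctor F H) (compFunctor G H) where
  toTwoNatTrans := TwoNatTrans.whiskerRight α.toTwoNatTrans H.toFunctor
  compat x := by
    change (H.iApp (F.toFunctor.obj x) ≫ H.toFunctor.map (F.iApp x)) ≫
      H.toFunctor.map (α.app (A.inv.dObj x)) =
      C.inv.dMap (H.toFunctor.map (α.app x)) ≫
        H.iApp (G.toFunctor.obj x) ≫ H.toFunctor.map (G.iApp x)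
    rw [← Strict.assoc, H.iApp_naturality, Strict.assoc, Strict.assoc, ← H.toFunctor.map_comp,
      ← H.toFunctor.map_comp, α.compat']

theorem idFunctor_comp (F : DualityFunctor A B) : compFunctor (idFunctor A) F = F :=
  DualityFunctor.ext (strictPseudofunctor_ext rfl) fun x => heq_of_eq <| by
    change F.iApp x.unco ≫ F.toFunctor.map (𝟙 (A.inv.dObj x.unco)) = F.iApp x.unco
    rw [F.toFunctor.map_id, Strict.comp_id]

theorem comp_idFunctor (F : DualityFunctor A B) : compFunctor F (idFunctor B) = F :=
  DualityFunctor.ext (strictPseudofunctor_ext rfl) fun _ => heq_of_eq <| Strict.id_comp _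

theorem compFunctor_assoc (F : DualityFunctor A B) (G : DualityFunctor B C)
    (H : DualityFunctor C D) :
    compFunctor (compFunctor F G) H = compFunctor F (compFunctor G H) :=
  DualityFunctor.ext (strictPseudofunctor_ext rfl) fun x => heq_of_eq <| by
    change H.iApp (G.toFunctor.obj (F.toFunctor.obj x.unco)) ≫
      H.toFunctor.map (G.iApp (F.toFunctor.obj x.unco) ≫ G.toFunctor.map (F.iApp x.unco)) =
      (H.iApp (G.toFunctor.obj (F.toFunctor.obj x.unco)) ≫
        H.toFunctor.map (G.iApp (F.toFunctor.obj x.unco))) ≫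
        H.toFunctor.map (G.toFunctor.map (F.iApp x.unco))
    rw [H.toFunctor.map_comp, Strict.assoc]

theorem eqToHom_app {F G : DualityFunctor A B} (h : F = G) (x : A.carrier) :
    HEq (TwoNatTrans.app (DualityNatTrans.toTwoNatTrans (eqToHom h)) x) (𝟙 (F.toFunctor.obj x)) := by
  subst h
  rfl

theorem whiskerLeftTrans_eqToHom (F : DualityFunctor A B) {G H : DualityFunctor B C}
    (h : G = H) :
    whiskerLeftTrans F (eqToHom h) = eqToHom (congrArg (compFunctor F) h) := by
  subst h
  rfl

theorem whiskerRightTrans_eqToHom {F G : DualityFunctor A B} (h : F = G)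
    (H : DualityFunctor B C) :
    whiskerRightTrans (eqToHom h) H = eqToHom (congrArg (compFunctor · H) h) := by
  subst h
  exact DualityNatTrans.ext fun x => H.toFunctor.map_id _

theorem assoc_app (F : DualityFunctor A B) (G : DualityFunctor B C) (H : DualityFunctor C D)
    (x : A.carrier) :
    TwoNatTrans.app (DualityNatTrans.toTwoNatTrans (eqToHom (compFunctor_assoc F G H))) x =
      𝟙 (H.toFunctor.obj (G.toFunctor.obj (F.toFunctor.obj x))) :=
  eq_of_heq (eqToHom_app _ x)

theorem assoc_symm_app (F : DualityFunctor A B) (G : DualityFunctor B C)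
    (H : DualityFunctor C D) (x : A.carrier) :
    TwoNatTrans.app (DualityNatTrans.toTwoNatTrans (eqToHom (compFunctor_assoc F G H).symm)) x =
      𝟙 (H.toFunctor.obj (G.toFunctor.obj (F.toFunctor.obj x))) :=
  eq_of_heq (eqToHom_app _ x)

theorem id_comp_app (F : DualityFunctor A B) (x : A.carrier) :
    TwoNatTrans.app (DualityNatTrans.toTwoNatTrans (eqToHom (idFunctor_comp F))) x =
      𝟙 (F.toFunctor.obj x) :=
  eq_of_heq (eqToHom_app _ x)

theorem id_comp_symm_app (F : DualityFunctor A B) (x : A.carrier) :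
    TwoNatTrans.app (DualityNatTrans.toTwoNatTrans (eqToHom (idFunctor_comp F).symm)) x =
      𝟙 (F.toFunctor.obj x) :=
  eq_of_heq (eqToHom_app _ x)

theorem comp_id_app (F : DualityFunctor A B) (x : A.carrier) :
    TwoNatTrans.app (DualityNatTrans.toTwoNatTrans (eqToHom (comp_idFunctor F))) x =
      𝟙 (F.toFunctor.obj x) :=
  eq_of_heq (eqToHom_app _ x)

theorem comp_id_symm_app (F : DualityFunctor A B) (x : A.carrier) :
    TwoNatTrans.app (DualityNatTrans.toTwoNatTrans (eqToHom (comp_idFunctor F).symm)) x =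
      𝟙 (F.toFunctor.obj x) :=
  eq_of_heq (eqToHom_app _ x)

/-- The 2-category of 2-categories with strong duality involutions, duality 2-functors, and
duality 2-natural transformations. -/
instance : Bicategory DualityTwoCat.{w, v, u} where
  Hom A B := DualityFunctor A B
  id A := idFunctor A
  comp F G := compFunctor F G
  homCategory A B := homCategory A B
  whiskerLeft F _ _ α := whiskerLeftTrans F α
  whiskerRight α H := whiskerRightTrans α H
  associator F G H := eqToIso (compFunctor_assoc F G H)
  leftUnitor F := eqToIso (idFunctor_comp F)
  rightUnitor F := eqToIso (comp_idFunctor F)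
  whiskerLeft_id F G := DualityNatTrans.ext fun x => rfl
  whiskerLeft_comp F _ _ _ α β := DualityNatTrans.ext fun x => rfl
  id_whiskerLeft {A B F G} α := DualityNatTrans.ext fun x =>
    (conj_id (id_comp_app F x) (id_comp_symm_app G x) _).symm
  comp_whiskerLeft {_ _ _ _} F G {H H'} α := DualityNatTrans.ext fun x =>
    (conj_id (assoc_app F G H x) (assoc_symm_app F G H' x) _).symm
  id_whiskerRight F G := DualityNatTrans.ext fun x => G.toFunctor.map_id _
  comp_whiskerRight α β G := DualityNatTrans.ext fun x => G.toFunctor.map_comp _ _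
  whiskerRight_id {A B F G} α := DualityNatTrans.ext fun x =>
    (conj_id (comp_id_app F x) (comp_id_symm_app G x) _).symm
  whiskerRight_comp {_ _ _ _ F F'} α G H := DualityNatTrans.ext fun x =>
    (conj_id (assoc_symm_app F G H x) (assoc_app F' G H x) _).symm
  whisker_assoc {_ _ _ _} F {G G'} α H := DualityNatTrans.ext fun x =>
    (conj_id (assoc_app F G H x) (assoc_symm_app F G' H x) _).symm
  whisker_exchange {_ _ _ F G H K} α β := DualityNatTrans.ext fun x =>
    (β.naturality (α.app x)).symm
  pentagon F G H K := by
    simp only [eqToIso.hom, whiskerLeftTrans_eqToHom, whiskerRightTrans_eqToHom, eqToHom_trans]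
  triangle F G := by
    simp only [eqToIso.hom, whiskerLeftTrans_eqToHom, whiskerRightTrans_eqToHom, eqToHom_trans]

instance : Strict DualityTwoCat.{w, v, u} where
  id_comp F := idFunctor_comp F
  comp_id F := comp_idFunctor F
  assoc F G H := compFunctor_assoc F G H
  leftUnitor_eqToIso _ := rfl
  rightUnitor_eqToIso _ := rfl
  associator_eqToIso _ _ _ := rfl

end DualityTwoCat
end DualityInvolutions
/-! ### 2-categories with contravariance -/

section Contravariance

/-- Horizontal composition of 2-cells in a 2-category. -/
def hcomp {A : Type u} [Bicategory.{w, v} A] {x y z : A} {f f' : x ⟶ y} {g g' : y ⟶ z}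
    (φ : f ⟶ f') (γ : g ⟶ g') : f ≫ g ⟶ f' ≫ g' :=
  φ ▷ g ≫ f' ◁ γ

/-- The data of a contravariance structure on a 2-category `A`, whose hom-categories `x ⟶ y` are
the categories `A⁺(x, y)` of covariant morphisms: categories `Neg x y`, i.e. `A⁻(x, y)`, of
contravariant morphisms, and the three composition functors involving them. As for `≫`, factors
are in diagrammatic order: `compPN`, say, composes a covariant morphism followed by a
contravariant one. A contravariant second factor reverses the 2-cells of the first factor. -/
structure ContravarianceData (A : Type u) [Bicategory.{w, v} A] where
  Neg : A → A → Type v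
  [negCategory : ∀ x y, Category.{w} (Neg x y)]
  compNN (x y z : A) : (Neg x y)ᵒᵖ × Neg y z ⥤ (x ⟶ z)
  compNP (x y z : A) : Neg x y × (y ⟶ z) ⥤ Neg x z
  compPN (x y z : A) : (x ⟶ y)ᵒᵖ × Neg y z ⥤ Neg x z

namespace ContravarianceData

attribute [instance] ContravarianceData.negCategory

variable {A : Type u} [Bicategory.{w, v} A] (K : ContravarianceData A) {x y z : A}

/-- The composite of two contravariant morphisms. -/
def nn (f : K.Neg x y) (g : K.Neg y z) : x ⟶ z := (K.compNN x y z).obj (op f, g)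

/-- The composite of a contravariant morphism followed by a covariant one. -/
def np (f : K.Neg x y) (g : y ⟶ z) : K.Neg x z := (K.compNP x y z).obj (f, g)

/-- The composite of a covariant morphism followed by a contravariant one. -/
def pn (f : x ⟶ y) (g : K.Neg y z) : K.Neg x z := (K.compPN x y z).obj (op f, g)

/-- The action of `nn` on 2-cells. -/
def nn₂ {f f' : K.Neg x y} {g g' : K.Neg y z} (φ : f' ⟶ f) (γ : g ⟶ g') :
    K.nn f g ⟶ K.nn f' g' :=
  (K.compNN x y z).map (X := (op f, g)) (Y := (op f', g')) (φ.op, γ)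

/-- The action of `np` on 2-cells. -/
def np₂ {f f' : K.Neg x y} {g g' : y ⟶ z} (φ : f ⟶ f') (γ : g ⟶ g') :
    K.np f g ⟶ K.np f' g' :=
  (K.compNP x y z).map (X := (f, g)) (Y := (f', g')) (φ, γ)

/-- The action of `pn` on 2-cells. -/
def pn₂ {f f' : x ⟶ y} {g g' : K.Neg y z} (φ : f' ⟶ f) (γ : g ⟶ g') :
    K.pn f g ⟶ K.pn f' g' :=
  (K.compPN x y z).map (X := (op f, g)) (Y := (op f', g')) (φ.op, γ)

end ContravarianceData

/-- The laws of a contravariance structure on a 2-category `A`. Together with the two unit laws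
and the associativity law of the 2-category `A` itself (the ones that involve covariant morphisms
only), these are the four unit laws and the eight associativity laws of a 2-category with
contravariance, each stated on 1-cells and on 2-cells. -/
structure ContravarianceData.Lawful {A : Type u} [Bicategory.{w, v} A]
    (K : ContravarianceData A) : Prop where
  id_neg {x y : A} (f : K.Neg x y) : K.pn (𝟙 x) f = f
  id_neg₂ {x y : A} {f f' : K.Neg x y} (φ : f ⟶ f') :
    HEq (K.pn₂ (𝟙 (𝟙 x)) φ) φ
  neg_id {x y : A} (f : K.Neg x y) : K.np f (𝟙 y) = f
  neg_id₂ {x y : A} {f f' : K.Neg x y} (φ : f ⟶ f') :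
    HEq (K.np₂ φ (𝟙 (𝟙 y))) φ
  assoc_ppn {a b c d : A} (f : a ⟶ b) (g : b ⟶ c) (h : K.Neg c d) :
    K.pn (f ≫ g) h =
      K.pn f (K.pn g h)
  assoc_ppn₂ {a b c d : A} {f f' : a ⟶ b} {g g' : b ⟶ c} {h h' : K.Neg c d}
    (φ : f' ⟶ f) (γ : g' ⟶ g) (θ : h ⟶ h') :
    HEq (K.pn₂ (hcomp φ γ) θ)
      (K.pn₂ φ (K.pn₂ γ θ))
  assoc_pnp {a b c d : A} (f : a ⟶ b) (g : K.Neg b c) (h : c ⟶ d) :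
    K.np (K.pn f g) h =
      K.pn f (K.np g h)
  assoc_pnp₂ {a b c d : A} {f f' : a ⟶ b} {g g' : K.Neg b c} {h h' : c ⟶ d}
    (φ : f' ⟶ f) (γ : g ⟶ g') (θ : h ⟶ h') :
    HEq (K.np₂ (K.pn₂ φ γ) θ)
      (K.pn₂ φ (K.np₂ γ θ))
  assoc_npp {a b c d : A} (f : K.Neg a b) (g : b ⟶ c) (h : c ⟶ d) :
    K.np (K.np f g) h =
      K.np f (g ≫ h)
  assoc_npp₂ {a b c d : A} {f f' : K.Neg a b} {g g' : b ⟶ c} {h h' : c ⟶ d}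
    (φ : f ⟶ f') (γ : g ⟶ g') (θ : h ⟶ h') :
    HEq (K.np₂ (K.np₂ φ γ) θ)
      (K.np₂ φ (hcomp γ θ))
  assoc_pnn {a b c d : A} (f : a ⟶ b) (g : K.Neg b c) (h : K.Neg c d) :
    K.nn (K.pn f g) h =
      f ≫ K.nn g h
  assoc_pnn₂ {a b c d : A} {f f' : a ⟶ b} {g g' : K.Neg b c} {h h' : K.Neg c d}
    (φ : f ⟶ f') (γ : g' ⟶ g) (θ : h ⟶ h') :
    HEq (K.nn₂ (K.pn₂ φ γ) θ)
      (hcomp φ (K.nn₂ γ θ))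
  assoc_npn {a b c d : A} (f : K.Neg a b) (g : b ⟶ c) (h : K.Neg c d) :
    K.nn (K.np f g) h =
      K.nn f (K.pn g h)
  assoc_npn₂ {a b c d : A} {f f' : K.Neg a b} {g g' : b ⟶ c} {h h' : K.Neg c d}
    (φ : f' ⟶ f) (γ : g' ⟶ g) (θ : h ⟶ h') :
    HEq (K.nn₂ (K.np₂ φ γ) θ)
      (K.nn₂ φ (K.pn₂ γ θ))
  assoc_nnp {a b c d : A} (f : K.Neg a b) (g : K.Neg b c) (h : c ⟶ d) :
    K.nn f g ≫ h =
      K.nn f (K.np g h)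
  assoc_nnp₂ {a b c d : A} {f f' : K.Neg a b} {g g' : K.Neg b c} {h h' : c ⟶ d}
    (φ : f' ⟶ f) (γ : g ⟶ g') (θ : h ⟶ h') :
    HEq (hcomp (K.nn₂ φ γ) θ)
      (K.nn₂ φ (K.np₂ γ θ))
  assoc_nnn {a b c d : A} (f : K.Neg a b) (g : K.Neg b c) (h : K.Neg c d) :
    K.pn (K.nn f g) h =
      K.np f (K.nn g h)
  assoc_nnn₂ {a b c d : A} {f f' : K.Neg a b} {g g' : K.Neg b c} {h h' : K.Neg c d}
    (φ : f ⟶ f') (γ : g' ⟶ g) (θ : h ⟶ h') :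
    HEq (K.pn₂ (K.nn₂ φ γ) θ)
      (K.np₂ φ (K.nn₂ γ θ))

/-- A contravariance structure on a 2-category. -/
structure Contravariance (A : Type u) [Bicategory.{w, v} A] extends ContravarianceData A where
  lawful : toContravarianceData.Lawful

namespace ContravarianceData

variable {A : Type u} [Bicategory.{w, v} A] (K : ContravarianceData A) {x y : A}

/-- Postcomposition with a covariant morphism, on contravariant morphisms. -/
def postP {y z : A} (g : y ⟶ z) (x : A) : K.Neg x y ⥤ K.Neg x z :=
  Prod.sectL (K.Neg x y) g ⋙ K.compNP x y z

/-- Precomposition with a covariant morphism, on contravariant morphisms. -/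
def preP {x y : A} (f : x ⟶ y) (z : A) : K.Neg y z ⥤ K.Neg x z :=
  Prod.sectR (op f) (K.Neg y z) ⋙ K.compPN x y z

/-- Precomposition with a contravariant morphism, on covariant morphisms. -/
def preNP {x y : A} (χ : K.Neg x y) (z : A) : (y ⟶ z) ⥤ K.Neg x z :=
  Prod.sectR χ (y ⟶ z) ⋙ K.compNP x y z

/-- Precomposition with a contravariant morphism, on contravariant morphisms. -/
def preNN {x y : A} (χ : K.Neg x y) (z : A) : K.Neg y z ⥤ (x ⟶ z) :=
  Prod.sectR (op χ) (K.Neg y z) ⋙ K.compNN x y z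

/-- A functor is an isomorphism of categories. -/
def IsIsomorphism {C : Type u₁} [Category.{v₁} C] {D : Type u₂} [Category.{v₂} D]
    (F : C ⥤ D) : Prop :=
  ∃ G : D ⥤ C, F ⋙ G = 𝟭 C ∧ G ⋙ F = 𝟭 D

/-- The contravariant morphism `χ : x ⟶ x'` exhibits `x'` as a strict opposite of `x`. -/
def IsOpposite {x x' : A} (χ : K.Neg x x') : Prop :=
  ∀ y : A, IsIsomorphism (K.preNP χ y) ∧ IsIsomorphism (K.preNN χ y)

/-- Every object has a strict opposite. -/
def HasOpposites : Prop :=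
  ∀ x : A, ∃ (x' : A) (χ : K.Neg x x'), K.IsOpposite χ

end ContravarianceData

set_option linter.checkUnivs false in
/-- A 2-category with contravariance. -/
structure ContraTwoCat where
  carrier : Type u
  [bicategory : Bicategory.{w, v} carrier]
  [strict : Strict carrier]
  contra : Contravariance carrier

attribute [instance] ContraTwoCat.bicategory ContraTwoCat.strict

/-- A 2-functor preserving contravariance: a strict 2-functor on covariant morphisms and functors
between the categories of contravariant morphisms, commuting with all composition functors. -/
structure ContraFunctor (A B : ContraTwoCat.{w, v, u}) where
  toFunctor : StrictPseudofunctor A.carrier B.carrier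
  neg (x y : A.carrier) :
    A.contra.Neg x y ⥤ B.contra.Neg (toFunctor.obj x) (toFunctor.obj y)
  map_nn (x y z : A.carrier) :
    A.contra.compNN x y z ⋙ toFunctor.mapFunctor x z =
      (neg x y).op.prod (neg y z) ⋙ B.contra.compNN _ _ _
  map_np (x y z : A.carrier) :
    A.contra.compNP x y z ⋙ neg x z =
      (neg x y).prod (toFunctor.mapFunctor y z) ⋙ B.contra.compNP _ _ _
  map_pn (x y z : A.carrier) :
    A.contra.compPN x y z ⋙ neg x z =
      (toFunctor.mapFunctor x y).op.prod (neg y z) ⋙ B.contra.compPN _ _ _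

/-- A 2-natural transformation respecting contravariance: a strict 2-natural transformation (with
covariant components) which is natural for contravariant morphisms and their 2-cells too. -/
structure ContraNatTrans {A B : ContraTwoCat.{w, v, u}} (F G : ContraFunctor A B) extends
    TwoNatTrans F.toFunctor G.toFunctor where
  neg_naturality (x y : A.carrier) :
    F.neg x y ⋙ B.contra.postP (app y) (F.toFunctor.obj x) =
      G.neg x y ⋙ B.contra.preP (app x) (G.toFunctor.obj y)

namespace ContravarianceData.Lawful

variable {A : Type u} [Bicategory.{w, v} A] {K : ContravarianceData A}

theorem postP_id (hK : K.Lawful) (x y : A) : K.postP (𝟙 y) x = 𝟭 _ :=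
  Functor.hext (fun f => hK.neg_id f) fun _ _ φ => hK.neg_id₂ φ

theorem preP_id (hK : K.Lawful) (x y : A) : K.preP (𝟙 x) y = 𝟭 _ :=
  Functor.hext (fun f => hK.id_neg f) fun _ _ φ => hK.id_neg₂ φ

theorem hcomp_id {x y z : A} (f : x ⟶ y) (g : y ⟶ z) : hcomp (𝟙 f) (𝟙 g) = 𝟙 (f ≫ g) := by
  simp [hcomp]

theorem postP_comp (hK : K.Lawful) {x y z : A} (f : x ⟶ y) (g : y ⟶ z) (a : A) :
    K.postP (f ≫ g) a = K.postP f a ⋙ K.postP g a :=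
  Functor.hext (fun h => (hK.assoc_npp h f g).symm) fun _ _ φ => by
    have := hK.assoc_npp₂ φ (𝟙 f) (𝟙 g)
    rw [hcomp_id] at this
    exact this.symm

theorem preP_comp (hK : K.Lawful) {x y z : A} (f : x ⟶ y) (g : y ⟶ z) (a : A) :
    K.preP (f ≫ g) a = K.preP g a ⋙ K.preP f a :=
  Functor.hext (fun h => hK.assoc_ppn f g h) fun _ _ φ => by
    have := hK.assoc_ppn₂ (𝟙 f) (𝟙 g) φ
    rw [hcomp_id] at this
    exact this

theorem preP_postP (hK : K.Lawful) {x y z t : A} (f : x ⟶ y) (g : z ⟶ t) :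
    K.preP f z ⋙ K.postP g x = K.postP g y ⋙ K.preP f t :=
  Functor.hext (fun h => hK.assoc_pnp f h g) fun _ _ φ => hK.assoc_pnp₂ (𝟙 f) φ (𝟙 g)

end ContravarianceData.Lawful

theorem ContraFunctor.ext {A B : ContraTwoCat.{w, v, u}} {F G : ContraFunctor A B}
    (h : F.toFunctor = G.toFunctor) (hn : ∀ x y, HEq (F.neg x y) (G.neg x y)) : F = G := by
  obtain ⟨F, m, _, _, _⟩ := F
  obtain ⟨G, n, _, _, _⟩ := G
  obtain rfl : F = G := h
  obtain rfl : m = n := funext fun x => funext fun y => eq_of_heq (hn x y)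
  rfl

theorem ContraFunctor.neg_postP {A B : ContraTwoCat.{w, v, u}} (F : ContraFunctor A B)
    {y z : A.carrier} (g : y ⟶ z) (x : A.carrier) :
    A.contra.postP g x ⋙ F.neg x z =
      F.neg x y ⋙ B.contra.postP (F.toFunctor.map g) (F.toFunctor.obj x) := by
  have h := congrArg (Prod.sectL (A.contra.Neg x y) g ⋙ ·) (F.map_np x y z)
  refine h.trans ?_
  refine Functor.hext (fun _ => rfl) fun X Y φ => heq_of_eq ?_
  exact congrArg (fun θ => B.contra.np₂ ((F.neg x y).map φ) θ) (F.toFunctor.map₂_id g)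

theorem ContraFunctor.neg_preP {A B : ContraTwoCat.{w, v, u}} (F : ContraFunctor A B)
    {x y : A.carrier} (f : x ⟶ y) (z : A.carrier) :
    A.contra.preP f z ⋙ F.neg x z =
      F.neg y z ⋙ B.contra.preP (F.toFunctor.map f) (F.toFunctor.obj z) := by
  have h := congrArg (Prod.sectR (op f) (A.contra.Neg y z) ⋙ ·) (F.map_pn x y z)
  refine h.trans ?_
  refine Functor.hext (fun _ => rfl) fun X Y φ => heq_of_eq ?_
  exact congrArg (fun θ => B.contra.pn₂ θ ((F.neg y z).map φ)) (F.toFunctor.map₂_id f)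

theorem ContraNatTrans.ext {A B : ContraTwoCat.{w, v, u}} {F G : ContraFunctor A B}
    {α β : ContraNatTrans F G} (h : ∀ x, α.app x = β.app x) : α = β := by
  obtain ⟨a, _⟩ := α
  obtain ⟨b, _⟩ := β
  obtain rfl : a = b := TwoNatTrans.ext h
  rfl

namespace ContraTwoCat

variable {A B C D : ContraTwoCat.{w, v, u}}

/-- The identity 2-functor preserving contravariance. -/
def idFunctor (A : ContraTwoCat.{w, v, u}) : ContraFunctor A A where
  toFunctor := StrictPseudofunctor.id A.carrier
  neg _ _ := 𝟭 _
  map_nn _ _ _ := rfl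
  map_np _ _ _ := rfl
  map_pn _ _ _ := rfl

/-- Composition of 2-functors preserving contravariance. -/
def compFunctor (F : ContraFunctor A B) (G : ContraFunctor B C) : ContraFunctor A C where
  toFunctor := F.toFunctor.comp G.toFunctor
  neg x y := F.neg x y ⋙ G.neg _ _
  map_nn x y z := (congrArg (· ⋙ G.toFunctor.mapFunctor _ _) (F.map_nn x y z)).trans
    (congrArg ((F.neg x y).op.prod (F.neg y z) ⋙ ·) (G.map_nn _ _ _))
  map_np x y z := (congrArg (· ⋙ G.neg _ _) (F.map_np x y z)).trans
    (congrArg ((F.neg x y).prod (F.toFunctor.mapFunctor y z) ⋙ ·) (G.map_np _ _ _))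
  map_pn x y z := (congrArg (· ⋙ G.neg _ _) (F.map_pn x y z)).trans
    (congrArg ((F.toFunctor.mapFunctor x y).op.prod (F.neg y z) ⋙ ·) (G.map_pn _ _ _))

/-- The identity 2-natural transformation respecting contravariance. -/
def idTrans (F : ContraFunctor A B) : ContraNatTrans F F where
  toTwoNatTrans := TwoNatTrans.id F.toFunctor
  neg_naturality x y := congrArg (F.neg x y ⋙ ·)
    ((B.contra.lawful.postP_id _ _).trans (B.contra.lawful.preP_id _ _).symm)

/-- Vertical composition of 2-natural transformations respecting contravariance. -/
def vcompTrans {F G H : ContraFunctor A B} (α : ContraNatTrans F G)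
    (β : ContraNatTrans G H) : ContraNatTrans F H where
  toTwoNatTrans := α.toTwoNatTrans.vcomp β.toTwoNatTrans
  neg_naturality x y := by
    change F.neg x y ⋙ B.contra.postP (α.app y ≫ β.app y) (F.toFunctor.obj x) =
      H.neg x y ⋙ B.contra.preP (α.app x ≫ β.app x) (H.toFunctor.obj y)
    rw [B.contra.lawful.postP_comp, B.contra.lawful.preP_comp, ← Functor.assoc,
      α.neg_naturality, Functor.assoc, B.contra.lawful.preP_postP, ← Functor.assoc,
      β.neg_naturality, Functor.assoc]

instance homCategory (A B : ContraTwoCat.{w, v, u}) : Category (ContraFunctor A B) where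
  Hom F G := ContraNatTrans F G
  id F := idTrans F
  comp α β := vcompTrans α β
  id_comp _ := ContraNatTrans.ext fun _ => Strict.id_comp _
  comp_id _ := ContraNatTrans.ext fun _ => Strict.comp_id _
  assoc _ _ _ := ContraNatTrans.ext fun _ => Strict.assoc _ _ _

/-- Whiskering by a 2-functor preserving contravariance on the source side. -/
def whiskerLeftTrans (F : ContraFunctor A B) {G H : ContraFunctor B C}
    (α : ContraNatTrans G H) : ContraNatTrans (compFunctor F G) (compFunctor F H) where
  toTwoNatTrans := TwoNatTrans.whiskerLeft F.toFunctor α.toTwoNatTrans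
  neg_naturality x y := congrArg (F.neg x y ⋙ ·) (α.neg_naturality _ _)

/-- Whiskering by a 2-functor preserving contravariance on the target side. -/
def whiskerRightTrans {F G : ContraFunctor A B} (α : ContraNatTrans F G)
    (H : ContraFunctor B C) : ContraNatTrans (compFunctor F H) (compFunctor G H) where
  toTwoNatTrans := TwoNatTrans.whiskerRight α.toTwoNatTrans H.toFunctor
  neg_naturality x y :=
    (congrArg (F.neg x y ⋙ ·) (H.neg_postP (α.app y) (F.toFunctor.obj x))).symm.trans
      ((congrArg (· ⋙ H.neg _ _) (α.neg_naturality x y)).trans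
        (congrArg (G.neg x y ⋙ ·) (H.neg_preP (α.app x) (G.toFunctor.obj y))))

theorem idFunctor_comp (F : ContraFunctor A B) : compFunctor (idFunctor A) F = F :=
  ContraFunctor.ext (strictPseudofunctor_ext rfl) fun _ _ => HEq.rfl

theorem comp_idFunctor (F : ContraFunctor A B) : compFunctor F (idFunctor B) = F :=
  ContraFunctor.ext (strictPseudofunctor_ext rfl) fun _ _ => HEq.rfl

theorem compFunctor_assoc (F : ContraFunctor A B) (G : ContraFunctor B C)
    (H : ContraFunctor C D) :
    compFunctor (compFunctor F G) H = compFunctor F (compFunctor G H) :=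
  ContraFunctor.ext (strictPseudofunctor_ext rfl) fun _ _ => HEq.rfl

theorem eqToHom_app {F G : ContraFunctor A B} (h : F = G) (x : A.carrier) :
    HEq (TwoNatTrans.app (ContraNatTrans.toTwoNatTrans (eqToHom h)) x) (𝟙 (F.toFunctor.obj x)) := by
  subst h
  rfl

theorem whiskerLeftTrans_eqToHom (F : ContraFunctor A B) {G H : ContraFunctor B C}
    (h : G = H) :
    whiskerLeftTrans F (eqToHom h) = eqToHom (congrArg (compFunctor F) h) := by
  subst h
  rfl

theorem whiskerRightTrans_eqToHom {F G : ContraFunctor A B} (h : F = G)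
    (H : ContraFunctor B C) :
    whiskerRightTrans (eqToHom h) H = eqToHom (congrArg (compFunctor · H) h) := by
  subst h
  exact ContraNatTrans.ext fun x => H.toFunctor.map_id _

theorem assoc_app (F : ContraFunctor A B) (G : ContraFunctor B C) (H : ContraFunctor C D)
    (x : A.carrier) :
    TwoNatTrans.app (ContraNatTrans.toTwoNatTrans (eqToHom (compFunctor_assoc F G H))) x =
      𝟙 (H.toFunctor.obj (G.toFunctor.obj (F.toFunctor.obj x))) :=
  eq_of_heq (eqToHom_app _ x)

theorem assoc_symm_app (F : ContraFunctor A B) (G : ContraFunctor B C)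
    (H : ContraFunctor C D) (x : A.carrier) :
    TwoNatTrans.app (ContraNatTrans.toTwoNatTrans (eqToHom (compFunctor_assoc F G H).symm)) x =
      𝟙 (H.toFunctor.obj (G.toFunctor.obj (F.toFunctor.obj x))) :=
  eq_of_heq (eqToHom_app _ x)

theorem id_comp_app (F : ContraFunctor A B) (x : A.carrier) :
    TwoNatTrans.app (ContraNatTrans.toTwoNatTrans (eqToHom (idFunctor_comp F))) x =
      𝟙 (F.toFunctor.obj x) :=
  eq_of_heq (eqToHom_app _ x)

theorem id_comp_symm_app (F : ContraFunctor A B) (x : A.carrier) :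
    TwoNatTrans.app (ContraNatTrans.toTwoNatTrans (eqToHom (idFunctor_comp F).symm)) x =
      𝟙 (F.toFunctor.obj x) :=
  eq_of_heq (eqToHom_app _ x)

theorem comp_id_app (F : ContraFunctor A B) (x : A.carrier) :
    TwoNatTrans.app (ContraNatTrans.toTwoNatTrans (eqToHom (comp_idFunctor F))) x =
      𝟙 (F.toFunctor.obj x) :=
  eq_of_heq (eqToHom_app _ x)

theorem comp_id_symm_app (F : ContraFunctor A B) (x : A.carrier) :
    TwoNatTrans.app (ContraNatTrans.toTwoNatTrans (eqToHom (comp_idFunctor F).symm)) x =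
      𝟙 (F.toFunctor.obj x) :=
  eq_of_heq (eqToHom_app _ x)

/-- The 2-category of 2-categories with contravariance, 2-functors preserving contravariance, and
2-natural transformations respecting contravariance. -/
instance : Bicategory ContraTwoCat.{w, v, u} where
  Hom A B := ContraFunctor A B
  id A := idFunctor A
  comp F G := compFunctor F G
  homCategory A B := homCategory A B
  whiskerLeft F _ _ α := whiskerLeftTrans F α
  whiskerRight α H := whiskerRightTrans α H
  associator F G H := eqToIso (compFunctor_assoc F G H)
  leftUnitor F := eqToIso (idFunctor_comp F)
  rightUnitor F := eqToIso (comp_idFunctor F)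
  whiskerLeft_id F G := ContraNatTrans.ext fun x => rfl
  whiskerLeft_comp F _ _ _ α β := ContraNatTrans.ext fun x => rfl
  id_whiskerLeft {A B F G} α := ContraNatTrans.ext fun x =>
    (conj_id (id_comp_app F x) (id_comp_symm_app G x) _).symm
  comp_whiskerLeft {_ _ _ _} F G {H H'} α := ContraNatTrans.ext fun x =>
    (conj_id (assoc_app F G H x) (assoc_symm_app F G H' x) _).symm
  id_whiskerRight F G := ContraNatTrans.ext fun x => G.toFunctor.map_id _
  comp_whiskerRight α β G := ContraNatTrans.ext fun x => G.toFunctor.map_comp _ _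
  whiskerRight_id {A B F G} α := ContraNatTrans.ext fun x =>
    (conj_id (comp_id_app F x) (comp_id_symm_app G x) _).symm
  whiskerRight_comp {_ _ _ _ F F'} α G H := ContraNatTrans.ext fun x =>
    (conj_id (assoc_symm_app F G H x) (assoc_app F' G H x) _).symm
  whisker_assoc {_ _ _ _} F {G G'} α H := ContraNatTrans.ext fun x =>
    (conj_id (assoc_app F G H x) (assoc_symm_app F G' H x) _).symm
  whisker_exchange {_ _ _ F G H K} α β := ContraNatTrans.ext fun x =>
    (β.naturality (α.app x)).symm
  pentagon F G H K := by
    simp only [eqToIso.hom, whiskerLeftTrans_eqToHom, whiskerRightTrans_eqToHom, eqToHom_trans]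
  triangle F G := by
    simp only [eqToIso.hom, whiskerLeftTrans_eqToHom, whiskerRightTrans_eqToHom, eqToHom_trans]

instance : Strict ContraTwoCat.{w, v, u} where
  id_comp F := idFunctor_comp F
  comp_id F := comp_idFunctor F
  assoc F G H := compFunctor_assoc F G H
  leftUnitor_eqToIso _ := rfl
  rightUnitor_eqToIso _ := rfl
  associator_eqToIso _ _ _ := rfl

end ContraTwoCat

set_option linter.checkUnivs false in
/-- The 2-category of 2-categories with contravariance in which every object has a strict
opposite, 2-functors preserving contravariance, and 2-natural transformations respecting
contravariance: a full sub-2-category of `ContraTwoCat`. -/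
abbrev ContraTwoCatWithOpposites :=
  InducedBicategory ContraTwoCat.{w, v, u}
    (fun A : {A : ContraTwoCat.{w, v, u} // A.contra.HasOpposites} => A.1)

end Contravariance

end TwoDuality

/-! Composites are written in diagrammatic order. Both structures encode the same information,
because a contravariant morphism from x to y amounts to a covariant one from x° to y.

From an involution, put A⁻(x, y) = A(x°, y). A covariant f followed by a contravariant g is f°·g,
and two contravariant morphisms compose to y_x·f°·g. The laws reduce to functoriality of (-)°,
naturality of y and, for three contravariant factors, y_{x°} = (y_x)°. The identity of x° is then a
contravariant χ_x from x to x°, with inverse y_x⁻¹.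

Conversely, χ exhibits a strict opposite exactly when it has a two-sided contravariant inverse
(`isOpposite`, `exists_isInverse`). After choosing an invertible χ_x for each x, set f° =
χ_x⁻¹·f·χ_y, y_x = χ_x·χ_{x°}, and i_x = χ_{Fx}⁻¹·F(χ_x) for a 2-functor F. Every axiom becomes a
cancellation of adjacent inverse pairs. In particular i is the identity for an identity 2-functor,
and the intermediate choice cancels in a composite, so passing to involutions is strictly
2-functorial although the choices are arbitrary.

On the contravariance side the round trip replaces A⁻(x, y) by A⁺(x°, y), and precomposition with
χ_x identifies the two (`ofOpposite`). On the duality side it replaces the given opposites by chosen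
ones, and the two involutions are compared by the identity 2-functor with i_x = (χ'_x)⁻¹·χ_x, where
χ' is the new choice (`toChoice`).

Every law is needed for 1-cells and for 2-cells. Working with bundled 2-cells, with a 1-cell
embedded as its identity cell, gives both at once and turns heterogeneous equalities into plain
ones. -/

namespace TwoDuality

universe w₁ v₁ u₁ w₂ v₂ u₂ w₃ v₃ u₃

/-! ### Cells

Bundled 2-cells of a strict 2-category compose horizontally in a strictly associative and unital
way. Since 1-cells embed as identity cells, equalities of 1-cells and heterogeneous equalities of
2-cells reduce to equalities of cells. -/

section Cells

/-- A bundled morphism of a category. -/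
structure Cell (C : Type u) [Category.{v} C] where
  {src : C}
  {tgt : C}
  hom : src ⟶ tgt

namespace Cell

variable {C : Type u₁} [Category.{v₁} C] {D : Type u₂} [Category.{v₂} D]
  {E : Type u₃} [Category.{v₃} E]

/-- The identity cell. -/
def of (f : C) : Cell C := ⟨𝟙 f⟩

theorem of_injective {f g : C} (h : of f = of g) : f = g := congrArg Cell.src h

theorem mk_heq {a b a' b' : C} {f : a ⟶ b} {g : a' ⟶ b'} (h : Cell.mk f = Cell.mk g) :
    HEq f g := by
  cases h
  rfl

theorem mk_eq {a b a' b' : C} {f : a ⟶ b} {g : a' ⟶ b'} (h₁ : a = a') (h₂ : b = b')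
    (h : HEq f g) : Cell.mk f = Cell.mk g := by
  subst h₁ h₂
  rw [eq_of_heq h]

theorem mk_eqToHom_comp {a b c : C} (h : a = b) (f : b ⟶ c) :
    Cell.mk (eqToHom h ≫ f) = Cell.mk f := by
  subst h
  simp

theorem mk_comp_eqToHom {a b c : C} (f : a ⟶ b) (h : b = c) :
    Cell.mk (f ≫ eqToHom h) = Cell.mk f := by
  subst h
  simp

/-- The 2-dimensional axioms of strict 2-functors and strict 2-natural transformations are equations
up to conjugation by `eqToHom`; an equality of cells is converted to that form here. -/
theorem eq_conj {a b a' b' : C} {f : a ⟶ b} {g : a' ⟶ b'} (h₁ : a = a') (h₂ : b' = b)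
    (h : Cell.mk f = Cell.mk g) : f = eqToHom h₁ ≫ g ≫ eqToHom h₂ := by
  subst h₁ h₂
  simpa using eq_of_heq (mk_heq h)

/-- The reversed cell of the opposite category. -/
def op (φ : Cell C) : Cell Cᵒᵖ := ⟨φ.hom.op⟩

/-- A pair of cells. -/
def pair (φ : Cell C) (γ : Cell D) : Cell (C × D) :=
  ⟨(⟨φ.hom, γ.hom⟩ : (φ.src, γ.src) ⟶ (φ.tgt, γ.tgt))⟩

end Cell

variable {C : Type u₁} [Category.{v₁} C] {D : Type u₂} [Category.{v₂} D]
  {E : Type u₃} [Category.{v₃} E]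

/-- The action of a functor on cells. -/
def mapCell (F : C ⥤ D) (φ : Cell C) : Cell D := ⟨F.map φ.hom⟩

theorem mapCell_of (F : C ⥤ D) (f : C) : mapCell F (Cell.of f) = Cell.of (F.obj f) := by
  simp [mapCell, Cell.of]

/-- An object is the source of its identity cell, so agreement on cells already contains agreement
on objects. -/
theorem functor_ext_cell {F G : C ⥤ D} (h : ∀ φ, mapCell F φ = mapCell G φ) : F = G :=
  Functor.hext (fun f => congrArg Cell.src (h (Cell.of f)))
    fun _ _ φ => Cell.mk_heq (h ⟨φ⟩)

theorem mapCell_congr {F G : C ⥤ D} (h : F = G) (φ : Cell C) : mapCell F φ = mapCell G φ := by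
  rw [h]

end Cells

/-! ### Strictly associative and unital horizontal composition of cells -/

section HorizontalComposition

variable {A : Type u} [Bicategory.{w, v} A]

theorem hcomp_comp {x y z : A} {f f' f'' : x ⟶ y} {g g' g'' : y ⟶ z} (φ : f ⟶ f')
    (φ' : f' ⟶ f'') (γ : g ⟶ g') (γ' : g' ⟶ g'') :
    hcomp (φ ≫ φ') (γ ≫ γ') = hcomp φ γ ≫ hcomp φ' γ' := by
  simp [hcomp, whisker_exchange_assoc]

/-- The horizontal composition functor. -/
def hcompFunctor (x y z : A) : (x ⟶ y) × (y ⟶ z) ⥤ (x ⟶ z) where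
  obj p := p.1 ≫ p.2
  map φ := hcomp φ.1 φ.2
  map_id p := ContravarianceData.Lawful.hcomp_id p.1 p.2
  map_comp φ γ := hcomp_comp φ.1 γ.1 φ.2 γ.2

namespace Cell

/-- Horizontal composition of cells. -/
def comp {x y z : A} (φ : Cell (x ⟶ y)) (γ : Cell (y ⟶ z)) : Cell (x ⟶ z) :=
  ⟨hcomp φ.hom γ.hom⟩

/-- The identity cell of the identity 1-cell. -/
def one (x : A) : Cell (x ⟶ x) := of (𝟙 x)

theorem of_comp {x y z : A} (f : x ⟶ y) (g : y ⟶ z) : of (f ≫ g) = (of f).comp (of g) := by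
  simp [of, comp, ContravarianceData.Lawful.hcomp_id]

theorem of_comp_mk {x y z : A} (f : x ⟶ y) {g g' : y ⟶ z} (γ : g ⟶ g') :
    (of f).comp ⟨γ⟩ = ⟨f ◁ γ⟩ := by
  simp [of, comp, hcomp]

theorem mk_comp_of {x y z : A} {f f' : x ⟶ y} (φ : f ⟶ f') (g : y ⟶ z) :
    comp ⟨φ⟩ (of g) = ⟨φ ▷ g⟩ := by
  simp [of, comp, hcomp]

variable [Strict A]

-- In a strict 2-category the unitors and associators are `eqToHom`s, and bundling a 2-cell with its
-- endpoints makes these invisible. Hence this law, `comp_one` and `assoc` are honest equalities.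
@[simp]
theorem one_comp {x y : A} (φ : Cell (x ⟶ y)) : (one x).comp φ = φ := by
  obtain ⟨φ⟩ := φ
  rw [one, of_comp_mk, id_whiskerLeft, Strict.leftUnitor_eqToIso, Strict.leftUnitor_eqToIso]
  exact (mk_eqToHom_comp (Strict.id_comp _) _).trans (mk_comp_eqToHom _ (Strict.id_comp _).symm)

@[simp]
theorem comp_one {x y : A} (φ : Cell (x ⟶ y)) : φ.comp (one y) = φ := by
  obtain ⟨φ⟩ := φ
  rw [one, mk_comp_of, whiskerRight_id, Strict.rightUnitor_eqToIso, Strict.rightUnitor_eqToIso]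
  exact (mk_eqToHom_comp (Strict.comp_id _) _).trans (mk_comp_eqToHom _ (Strict.comp_id _).symm)

@[simp]
theorem assoc {a b c d : A} (φ : Cell (a ⟶ b)) (γ : Cell (b ⟶ c)) (θ : Cell (c ⟶ d)) :
    (φ.comp γ).comp θ = φ.comp (γ.comp θ) := by
  obtain ⟨φ⟩ := φ
  obtain ⟨γ⟩ := γ
  obtain ⟨θ⟩ := θ
  refine Eq.trans (congrArg Cell.mk ?_) ((mk_eqToHom_comp (Strict.assoc _ _ _)
    (hcomp φ (hcomp γ θ) ≫ eqToHom (Strict.assoc _ _ _).symm)).trans (mk_comp_eqToHom _ _))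
  change hcomp (hcomp φ γ) θ = _
  simp [hcomp, Strict.associator_eqToIso]

end Cell

end HorizontalComposition

/-! ### Strict 2-functors and 2-natural transformations described on cells -/

section StrictBuilders

variable {B : Type u₁} [Bicategory.{w₁, v₁} B] [Strict B] {C : Type u₂} [Bicategory.{w₂, v₂} C]
  [Strict C]

/-- The action of a strict 2-functor on cells. -/
def cellMap (F : StrictPseudofunctor B C) {x y : B} (φ : Cell (x ⟶ y)) :
    Cell (F.obj x ⟶ F.obj y) := mapCell (F.mapFunctor x y) φ

theorem cell_of (F : StrictPseudofunctor B C) {x y : B} (f : x ⟶ y) :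
    cellMap F (Cell.of f) = Cell.of (F.map f) := mapCell_of _ _

theorem cell_one (F : StrictPseudofunctor B C) (x : B) :
    cellMap F (Cell.one x) = Cell.one (F.obj x) := by
  rw [Cell.one, cell_of, F.map_id, Cell.one]

theorem cell_comp (F : StrictPseudofunctor B C) {x y z : B} (φ : Cell (x ⟶ y))
    (γ : Cell (y ⟶ z)) : cellMap F (φ.comp γ) =
      (cellMap F φ).comp (cellMap F γ) := by
  obtain ⟨φ⟩ := φ
  obtain ⟨γ⟩ := γ
  refine Eq.trans ?_ (Cell.mk_comp_eqToHom _ (F.map_comp _ _).symm)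
  refine Eq.trans ?_ (Cell.mk_eqToHom_comp (F.map_comp _ _) _)
  refine congrArg Cell.mk ?_
  change F.map₂ (hcomp φ γ) = _ ≫ hcomp (F.map₂ φ) (F.map₂ γ) ≫ _
  rw [hcomp, hcomp, PrelaxFunctor.map₂_comp, map₂_whiskerLeft_strict, map₂_whiskerRight_strict]
  simp

/-- A strict 2-functor from its action on hom-categories, functorial on cells. -/
def strictOfCell (obj : B → C) (hom : ∀ x y, (x ⟶ y) ⥤ (obj x ⟶ obj y))
    (one : ∀ x, mapCell (hom x x) (Cell.one x) = Cell.one (obj x))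
    (comp : ∀ {x y z : B} (φ : Cell (x ⟶ y)) (γ : Cell (y ⟶ z)),
      mapCell (hom x z) (φ.comp γ) = (mapCell (hom x y) φ).comp (mapCell (hom y z) γ)) :
    StrictPseudofunctor B C :=
  StrictPseudofunctor.mk''
    { obj := obj
      map := fun f => (hom _ _).obj f
      map₂ := fun η => (hom _ _).map η
      map₂_id := fun f => (hom _ _).map_id f
      map₂_comp := fun η θ => (hom _ _).map_comp η θ
      map_id := fun x => congrArg Cell.src (one x)
      map_comp := fun f g => congrArg Cell.src (comp (Cell.of f) (Cell.of g))
      map₂_whisker_left := fun f g g' η => Cell.eq_conj _ _ <| by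
        -- Whiskering is horizontal composition with an identity cell, so functoriality on cells
        -- contains both whiskering axioms.
        have h := comp (Cell.of f) ⟨η⟩
        rw [Cell.of_comp_mk, mapCell_of] at h
        exact h.trans (Cell.of_comp_mk _ _)
      map₂_whisker_right := fun {_ _ _ f f'} η g => Cell.eq_conj _ _ <| by
        have h := comp ⟨η⟩ (Cell.of g)
        rw [Cell.mk_comp_of, mapCell_of] at h
        exact h.trans (Cell.mk_comp_of _ _) }

/-- A strict 2-natural transformation from its components, natural on cells. -/
def twoNatTransOfCell {F G : StrictPseudofunctor B C} (app : ∀ a, F.obj a ⟶ G.obj a)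
    (nat : ∀ {a b : B} (φ : Cell (a ⟶ b)), (cellMap F φ).comp (Cell.of (app b)) =
      (Cell.of (app a)).comp (cellMap G φ)) : TwoNatTrans F G where
  app := app
  naturality f := congrArg Cell.src (nat (Cell.of f))
  naturality₂ η := Cell.eq_conj _ _ <|
    (Cell.mk_comp_of _ _).symm.trans ((nat ⟨η⟩).trans (Cell.of_comp_mk _ _))

theorem TwoNatTrans.cell_naturality {F G : StrictPseudofunctor B C} (α : TwoNatTrans F G)
    {a b : B} (φ : Cell (a ⟶ b)) :
    (cellMap F φ).comp (Cell.of (α.app b)) =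
      (Cell.of (α.app a)).comp (cellMap G φ) := by
  obtain ⟨φ⟩ := φ
  refine (Cell.mk_comp_of _ _).trans (Eq.trans ?_ (Cell.of_comp_mk _ _).symm)
  refine (congrArg Cell.mk (α.naturality₂ φ)).trans ?_
  exact (Cell.mk_eqToHom_comp _ _).trans (Cell.mk_comp_eqToHom _ _)

/-- A strict 2-natural isomorphism from its invertible components, natural on cells. -/
def twoNatIsoOfCell {F G : StrictPseudofunctor B C} (app : ∀ a, F.obj a ⟶ G.obj a)
    (nat : ∀ {a b : B} (φ : Cell (a ⟶ b)), (cellMap F φ).comp (Cell.of (app b)) =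
      (Cell.of (app a)).comp (cellMap G φ))
    (inv : ∀ a, ∃ g : G.obj a ⟶ F.obj a, app a ≫ g = 𝟙 _ ∧ g ≫ app a = 𝟙 _) :
    TwoNatIso F G where
  toTwoNatTrans := twoNatTransOfCell app nat
  exists_inv := TwoNatTrans.exists_inv _ inv

/-- The cell of `Bᶜᵒ` given by a cell of `B`. -/
def Cell.toCo {x y : B} (φ : Cell (x ⟶ y)) : Cell (Co.mk x ⟶ Co.mk y) := ⟨Co.mk₂ φ.hom⟩

/-- The cell of `B` given by a cell of `Bᶜᵒ`. -/
def Cell.ofCo {x y : Co B} (φ : Cell (x ⟶ y)) : Cell (x.unco ⟶ y.unco) := ⟨Co.un₂ φ.hom⟩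

/-- Reversing 2-cells swaps the two ways of writing a horizontal composite as a vertical composite
of whiskerings; the exchange law says that these agree. -/
theorem Cell.toCo_comp {x y z : B} (φ : Cell (x ⟶ y)) (γ : Cell (y ⟶ z)) :
    (φ.comp γ).toCo = φ.toCo.comp γ.toCo :=
  congrArg (Cell.mk (C := Co.mk x ⟶ Co.mk z)) (congrArg Co.mk₂ (whisker_exchange φ.hom γ.hom).symm)

theorem Cell.ofCo_comp {x y z : Co B} (φ : Cell (x ⟶ y)) (γ : Cell (y ⟶ z)) :
    (φ.comp γ).ofCo = φ.ofCo.comp γ.ofCo :=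
  congrArg Cell.mk (whisker_exchange (Co.un₂ φ.hom) (Co.un₂ γ.hom))

end StrictBuilders

/-! ### Cells of 2-categories with contravariance -/

namespace ContravarianceData

variable {A : Type u} [Bicategory.{w, v} A] (K : ContravarianceData A)

/-- Composition of cells: contravariant followed by contravariant. -/
def nnC {x y z : A} (φ : Cell (K.Neg x y)) (γ : Cell (K.Neg y z)) : Cell (x ⟶ z) :=
  ⟨K.nn₂ φ.hom γ.hom⟩

/-- Composition of cells: contravariant followed by covariant. -/
def npC {x y z : A} (φ : Cell (K.Neg x y)) (γ : Cell (y ⟶ z)) : Cell (K.Neg x z) :=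
  ⟨K.np₂ φ.hom γ.hom⟩

/-- Composition of cells: covariant followed by contravariant. -/
def pnC {x y z : A} (φ : Cell (x ⟶ y)) (γ : Cell (K.Neg y z)) : Cell (K.Neg x z) :=
  ⟨K.pn₂ φ.hom γ.hom⟩

variable {x y z : A}

theorem nnC_of (f : K.Neg x y) (g : K.Neg y z) :
    K.nnC (Cell.of f) (Cell.of g) = Cell.of (K.nn f g) :=
  mapCell_of (K.compNN x y z) (op f, g)

variable {K}

/-- The laws of a contravariance structure follow from their versions for cells. -/
theorem Lawful.ofCell
    (id_neg : ∀ {x y : A} (φ : Cell (K.Neg x y)), K.pnC (Cell.one x) φ = φ)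
    (neg_id : ∀ {x y : A} (φ : Cell (K.Neg x y)), K.npC φ (Cell.one y) = φ)
    (ppn : ∀ {a b c d : A} (φ : Cell (a ⟶ b)) (γ : Cell (b ⟶ c)) (θ : Cell (K.Neg c d)),
      K.pnC (φ.comp γ) θ = K.pnC φ (K.pnC γ θ))
    (pnp : ∀ {a b c d : A} (φ : Cell (a ⟶ b)) (γ : Cell (K.Neg b c)) (θ : Cell (c ⟶ d)),
      K.npC (K.pnC φ γ) θ = K.pnC φ (K.npC γ θ))
    (npp : ∀ {a b c d : A} (φ : Cell (K.Neg a b)) (γ : Cell (b ⟶ c)) (θ : Cell (c ⟶ d)),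
      K.npC (K.npC φ γ) θ = K.npC φ (γ.comp θ))
    (pnn : ∀ {a b c d : A} (φ : Cell (a ⟶ b)) (γ : Cell (K.Neg b c)) (θ : Cell (K.Neg c d)),
      K.nnC (K.pnC φ γ) θ = φ.comp (K.nnC γ θ))
    (npn : ∀ {a b c d : A} (φ : Cell (K.Neg a b)) (γ : Cell (b ⟶ c)) (θ : Cell (K.Neg c d)),
      K.nnC (K.npC φ γ) θ = K.nnC φ (K.pnC γ θ))
    (nnp : ∀ {a b c d : A} (φ : Cell (K.Neg a b)) (γ : Cell (K.Neg b c)) (θ : Cell (c ⟶ d)),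
      (K.nnC φ γ).comp θ = K.nnC φ (K.npC γ θ))
    (nnn : ∀ {a b c d : A} (φ : Cell (K.Neg a b)) (γ : Cell (K.Neg b c))
      (θ : Cell (K.Neg c d)), K.pnC (K.nnC φ γ) θ = K.npC φ (K.nnC γ θ)) :
    K.Lawful where
  id_neg f := congrArg Cell.src (id_neg (Cell.of f))
  id_neg₂ φ := Cell.mk_heq (id_neg ⟨φ⟩)
  neg_id f := congrArg Cell.src (neg_id (Cell.of f))
  neg_id₂ φ := Cell.mk_heq (neg_id ⟨φ⟩)
  assoc_ppn f g h := congrArg Cell.src (ppn (Cell.of f) (Cell.of g) (Cell.of h))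
  assoc_ppn₂ φ γ θ := Cell.mk_heq (ppn ⟨φ⟩ ⟨γ⟩ ⟨θ⟩)
  assoc_pnp f g h := congrArg Cell.src (pnp (Cell.of f) (Cell.of g) (Cell.of h))
  assoc_pnp₂ φ γ θ := Cell.mk_heq (pnp ⟨φ⟩ ⟨γ⟩ ⟨θ⟩)
  assoc_npp f g h := congrArg Cell.src (npp (Cell.of f) (Cell.of g) (Cell.of h))
  assoc_npp₂ φ γ θ := Cell.mk_heq (npp ⟨φ⟩ ⟨γ⟩ ⟨θ⟩)
  assoc_pnn f g h := congrArg Cell.src (pnn (Cell.of f) (Cell.of g) (Cell.of h))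
  assoc_pnn₂ φ γ θ := Cell.mk_heq (pnn ⟨φ⟩ ⟨γ⟩ ⟨θ⟩)
  assoc_npn f g h := congrArg Cell.src (npn (Cell.of f) (Cell.of g) (Cell.of h))
  assoc_npn₂ φ γ θ := Cell.mk_heq (npn ⟨φ⟩ ⟨γ⟩ ⟨θ⟩)
  assoc_nnp f g h := congrArg Cell.src (nnp (Cell.of f) (Cell.of g) (Cell.of h))
  assoc_nnp₂ φ γ θ := Cell.mk_heq (nnp ⟨φ⟩ ⟨γ⟩ ⟨θ⟩)
  assoc_nnn f g h := congrArg Cell.src (nnn (Cell.of f) (Cell.of g) (Cell.of h))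
  assoc_nnn₂ φ γ θ := Cell.mk_heq (nnn ⟨φ⟩ ⟨γ⟩ ⟨θ⟩)

end ContravarianceData

/-! ### Laws on cells, and strict opposites as invertible contravariant morphisms -/

namespace Contravariance

variable {A : Type u} [Bicategory.{w, v} A] (K : Contravariance A)

-- This and the associativity lemmas below are oriented so that `simp` brackets every string of
-- cells to the right, whatever the variances. Together with cancellation rules for inverse pairs,
-- this proves the identities of the second construction.
@[simp]
theorem one_pnC {x y : A} (φ : Cell (K.Neg x y)) : K.pnC (Cell.one x) φ = φ :=
  Cell.mk_eq (K.lawful.id_neg _) (K.lawful.id_neg _) (K.lawful.id_neg₂ _)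

@[simp]
theorem ppnC {a b c d : A} (φ : Cell (a ⟶ b)) (γ : Cell (b ⟶ c)) (θ : Cell (K.Neg c d)) :
    K.pnC (φ.comp γ) θ = K.pnC φ (K.pnC γ θ) :=
  Cell.mk_eq (K.lawful.assoc_ppn _ _ _) (K.lawful.assoc_ppn _ _ _) (K.lawful.assoc_ppn₂ _ _ _)

@[simp]
theorem pnpC {a b c d : A} (φ : Cell (a ⟶ b)) (γ : Cell (K.Neg b c)) (θ : Cell (c ⟶ d)) :
    K.npC (K.pnC φ γ) θ = K.pnC φ (K.npC γ θ) :=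
  Cell.mk_eq (K.lawful.assoc_pnp _ _ _) (K.lawful.assoc_pnp _ _ _) (K.lawful.assoc_pnp₂ _ _ _)

@[simp]
theorem nppC {a b c d : A} (φ : Cell (K.Neg a b)) (γ : Cell (b ⟶ c)) (θ : Cell (c ⟶ d)) :
    K.npC (K.npC φ γ) θ = K.npC φ (γ.comp θ) :=
  Cell.mk_eq (K.lawful.assoc_npp _ _ _) (K.lawful.assoc_npp _ _ _) (K.lawful.assoc_npp₂ _ _ _)

@[simp]
theorem pnnC {a b c d : A} (φ : Cell (a ⟶ b)) (γ : Cell (K.Neg b c)) (θ : Cell (K.Neg c d)) :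
    K.nnC (K.pnC φ γ) θ = φ.comp (K.nnC γ θ) :=
  Cell.mk_eq (K.lawful.assoc_pnn _ _ _) (K.lawful.assoc_pnn _ _ _) (K.lawful.assoc_pnn₂ _ _ _)

@[simp]
theorem npnC {a b c d : A} (φ : Cell (K.Neg a b)) (γ : Cell (b ⟶ c)) (θ : Cell (K.Neg c d)) :
    K.nnC (K.npC φ γ) θ = K.nnC φ (K.pnC γ θ) :=
  Cell.mk_eq (K.lawful.assoc_npn _ _ _) (K.lawful.assoc_npn _ _ _) (K.lawful.assoc_npn₂ _ _ _)

@[simp]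
theorem nnpC {a b c d : A} (φ : Cell (K.Neg a b)) (γ : Cell (K.Neg b c)) (θ : Cell (c ⟶ d)) :
    (K.nnC φ γ).comp θ = K.nnC φ (K.npC γ θ) :=
  Cell.mk_eq (K.lawful.assoc_nnp _ _ _) (K.lawful.assoc_nnp _ _ _) (K.lawful.assoc_nnp₂ _ _ _)

@[simp]
theorem nnnC {a b c d : A} (φ : Cell (K.Neg a b)) (γ : Cell (K.Neg b c))
    (θ : Cell (K.Neg c d)) : K.pnC (K.nnC φ γ) θ = K.npC φ (K.nnC γ θ) :=
  Cell.mk_eq (K.lawful.assoc_nnn _ _ _) (K.lawful.assoc_nnn _ _ _) (K.lawful.assoc_nnn₂ _ _ _)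

/-- A pair of mutually inverse contravariant morphisms. -/
structure IsInverse {x x' : A} (χ : K.Neg x x') (χ' : K.Neg x' x) : Prop where
  hom_inv : K.nn χ χ' = 𝟙 x
  inv_hom : K.nn χ' χ = 𝟙 x'

namespace IsInverse

variable {K} {x x' : A} {χ : K.Neg x x'} {χ' : K.Neg x' x}

theorem symm (h : K.IsInverse χ χ') : K.IsInverse χ' χ := ⟨h.inv_hom, h.hom_inv⟩

theorem nnC (h : K.IsInverse χ χ') : K.nnC (Cell.of χ) (Cell.of χ') = Cell.one x := by
  rw [K.nnC_of, h.hom_inv, Cell.one]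

/-- By associativity the two precompositions merge into precomposition with χ·χ' = 1. This rule and
`npC_nnC`, used for both orders of the pair, give the two isomorphisms in `isOpposite`. -/
theorem nnC_npC [Strict A] (h : K.IsInverse χ χ') {z : A} (φ : Cell (x ⟶ z)) :
    K.nnC (Cell.of χ) (K.npC (Cell.of χ') φ) = φ := by
  rw [← K.nnpC, h.nnC, Cell.one_comp]

theorem npC_nnC [Strict A] (h : K.IsInverse χ χ') {z : A} (φ : Cell (K.Neg x z)) :
    K.npC (Cell.of χ) (K.nnC (Cell.of χ') φ) = φ := by
  rw [← K.nnnC, h.nnC, K.one_pnC]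

/-- An invertible contravariant morphism exhibits its target as a strict opposite. -/
theorem isOpposite [Strict A] (h : K.IsInverse χ χ') : K.IsOpposite χ := fun y =>
  ⟨⟨K.preNN χ' y, functor_ext_cell fun φ => h.symm.nnC_npC φ,
      functor_ext_cell fun φ => h.npC_nnC φ⟩,
    ⟨K.preNP χ' y, functor_ext_cell fun φ => h.symm.npC_nnC φ,
      functor_ext_cell fun φ => h.nnC_npC φ⟩⟩

end IsInverse

/-- A contravariant morphism that exhibits a strict opposite is invertible. -/
theorem exists_isInverse [Strict A] {x x' : A} {χ : K.Neg x x'} (h : K.IsOpposite χ) :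
    ∃ χ' : K.Neg x' x, K.IsInverse χ χ' := by
  -- The isomorphism A⁻(x', x) ≅ A⁺(x, x) provides χ' as the preimage of 1_x; the isomorphism A⁺(x',
  -- x') ≅ A⁻(x, x') provides injectivity of precomposition with χ.
  obtain ⟨G, -, hG⟩ := (h x).2
  obtain ⟨H, hH, -⟩ := (h x').1
  have h₁ : K.nn χ (G.obj (𝟙 x)) = 𝟙 x := Functor.congr_obj hG (𝟙 x)
  refine ⟨G.obj (𝟙 x), h₁, ?_⟩
  -- χ·(χ'·χ) = (χ·χ')·χ = χ = χ·1, so injectivity forces χ'·χ = 1.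
  have h₂ : K.np χ (K.nn (G.obj (𝟙 x)) χ) = K.np χ (𝟙 x') := by
    rw [← K.lawful.assoc_nnn, h₁, K.lawful.id_neg, K.lawful.neg_id]
  exact (Functor.congr_obj hH _).symm.trans ((congrArg H.obj h₂).trans (Functor.congr_obj hH _))

end Contravariance

/-! ### 2-functors and 2-natural transformations with contravariance, on cells -/

namespace ContraFunctor

variable {A B : ContraTwoCat.{w, v, u}}

/-- The action of a 2-functor preserving contravariance on contravariant cells. -/
def negCell (F : ContraFunctor A B) {x y : A.carrier} (φ : Cell (A.contra.Neg x y)) :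
    Cell (B.contra.Neg (F.toFunctor.obj x) (F.toFunctor.obj y)) :=
  mapCell (F.neg x y) φ

variable (F : ContraFunctor A B) {x y z : A.carrier}

theorem negCell_of (f : A.contra.Neg x y) :
    F.negCell (Cell.of f) = Cell.of ((F.neg x y).obj f) := mapCell_of _ _

theorem cell_nnC (φ : Cell (A.contra.Neg x y)) (γ : Cell (A.contra.Neg y z)) :
    cellMap F.toFunctor (A.contra.nnC φ γ) = B.contra.nnC (F.negCell φ) (F.negCell γ) :=
  mapCell_congr (F.map_nn x y z) (Cell.pair φ.op γ)

theorem negCell_npC (φ : Cell (A.contra.Neg x y)) (γ : Cell (y ⟶ z)) :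
    F.negCell (A.contra.npC φ γ) = B.contra.npC (F.negCell φ) (cellMap F.toFunctor γ) :=
  mapCell_congr (F.map_np x y z) (Cell.pair φ γ)

theorem negCell_pnC (φ : Cell (x ⟶ y)) (γ : Cell (A.contra.Neg y z)) :
    F.negCell (A.contra.pnC φ γ) = B.contra.pnC (cellMap F.toFunctor φ) (F.negCell γ) :=
  mapCell_congr (F.map_pn x y z) (Cell.pair φ.op γ)

end ContraFunctor

/-- A 2-functor preserving contravariance from its action on hom-categories, functorial on
cells. -/
def contraFunctorOfCell {A B : ContraTwoCat.{w, v, u}}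
    (F : StrictPseudofunctor A.carrier B.carrier)
    (neg : ∀ x y, A.contra.Neg x y ⥤ B.contra.Neg (F.obj x) (F.obj y))
    (nn : ∀ {x y z : A.carrier} (φ : Cell (A.contra.Neg x y))
      (γ : Cell (A.contra.Neg y z)),
      cellMap F (A.contra.nnC φ γ) =
        B.contra.nnC (mapCell (neg x y) φ) (mapCell (neg y z) γ))
    (np : ∀ {x y z : A.carrier} (φ : Cell (A.contra.Neg x y)) (γ : Cell (y ⟶ z)),
      mapCell (neg x z) (A.contra.npC φ γ) = B.contra.npC (mapCell (neg x y) φ) (cellMap F γ))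
    (pn : ∀ {x y z : A.carrier} (φ : Cell (x ⟶ y)) (γ : Cell (A.contra.Neg y z)),
      mapCell (neg x z) (A.contra.pnC φ γ) = B.contra.pnC (cellMap F φ) (mapCell (neg y z) γ)) :
    ContraFunctor A B where
  toFunctor := F
  neg := neg
  -- A morphism of a product category is a pair of cells; the factor in the opposite category has to
  -- be reversed back.
  map_nn x y _ := functor_ext_cell fun φ => nn (x := x) (y := y) ⟨φ.hom.1.unop⟩ ⟨φ.hom.2⟩
  map_np x y _ := functor_ext_cell fun φ => np (x := x) (y := y) ⟨φ.hom.1⟩ ⟨φ.hom.2⟩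
  map_pn x y _ := functor_ext_cell fun φ => pn (x := x) (y := y) ⟨φ.hom.1.unop⟩ ⟨φ.hom.2⟩

/-- A 2-natural transformation respecting contravariance is determined by a 2-natural
transformation that is natural on contravariant cells. -/
def contraNatTransOfCell {A B : ContraTwoCat.{w, v, u}} {F G : ContraFunctor A B}
    (α : TwoNatTrans F.toFunctor G.toFunctor)
    (nat : ∀ {x y} (φ : Cell (A.contra.Neg x y)),
      B.contra.npC (F.negCell φ) (Cell.of (α.app y)) =
        B.contra.pnC (Cell.of (α.app x)) (G.negCell φ)) : ContraNatTrans F G where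
  toTwoNatTrans := α
  neg_naturality _ _ := functor_ext_cell nat

theorem ContraNatTrans.cell_neg_naturality {A B : ContraTwoCat.{w, v, u}}
    {F G : ContraFunctor A B} (α : ContraNatTrans F G) {x y : A.carrier}
    (φ : Cell (A.contra.Neg x y)) :
    B.contra.npC (F.negCell φ) (Cell.of (α.app y)) =
      B.contra.pnC (Cell.of (α.app x)) (G.negCell φ) :=
  mapCell_congr (α.neg_naturality x y) φ

/-! ### From duality involutions to contravariance -/

/-- Precomposition with a 1-cell. -/
def precompFunctor {A : Type u} [Bicategory.{w, v} A] {x y : A} (f : x ⟶ y) (z : A) :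
    (y ⟶ z) ⥤ (x ⟶ z) :=
  Prod.sectR f (y ⟶ z) ⋙ hcompFunctor x y z

namespace StrongDualityInvolution

variable {A : Type u} [Bicategory.{w, v} A] [Strict A] (S : StrongDualityInvolution A)

/-- The functor `f ↦ f°` on hom-categories. -/
def dFunctor (x y : A) : (x ⟶ y)ᵒᵖ ⥤ (S.dObj x ⟶ S.dObj y) :=
  S.dual.mapFunctor ⟨x⟩ ⟨y⟩

/-- The action of `(-)°` on cells. -/
def dCell {x y : A} (φ : Cell (x ⟶ y)) : Cell (S.dObj x ⟶ S.dObj y) :=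
  mapCell (S.dFunctor x y) φ.op

/-- The identity cell of `y_x`. -/
def yCell (x : A) : Cell (x ⟶ S.dObj (S.dObj x)) := Cell.of (S.yApp x)

theorem dCell_of {x y : A} (f : x ⟶ y) : S.dCell (Cell.of f) = Cell.of (S.dMap f) :=
  mapCell_of (S.dFunctor x y) (op f)

@[simp]
theorem dCell_one (x : A) : S.dCell (Cell.one x) = Cell.one (S.dObj x) := cell_one S.dual ⟨x⟩

@[simp]
theorem dCell_comp {x y z : A} (φ : Cell (x ⟶ y)) (γ : Cell (y ⟶ z)) :
    S.dCell (φ.comp γ) = (S.dCell φ).comp (S.dCell γ) :=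
  (congrArg (cellMap S.dual) (Cell.toCo_comp φ γ)).trans (cell_comp S.dual φ.toCo γ.toCo)

@[simp]
theorem dCell_yCell (x : A) : S.dCell (S.yCell x) = S.yCell (S.dObj x) := by
  rw [yCell, dCell_of, yCell]
  exact congrArg Cell.of (S.zeta x).symm

theorem yCell_naturality {x y : A} (φ : Cell (x ⟶ y)) :
    φ.comp (S.yCell y) = (S.yCell x).comp (S.dCell (S.dCell φ)) :=
  S.y.cell_naturality φ

theorem yCell_dCell_dCell_comp {x y z : A} (φ : Cell (x ⟶ y))
    (γ : Cell (S.dObj (S.dObj y) ⟶ z)) :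
    (S.yCell x).comp ((S.dCell (S.dCell φ)).comp γ) = φ.comp ((S.yCell y).comp γ) := by
  rw [← Cell.assoc, ← S.yCell_naturality, Cell.assoc]

/-- The contravariance structure given by a strong duality involution: the contravariant morphisms
from `x` to `y` are the morphisms from `x°` to `y`. -/
def contraData : ContravarianceData A where
  Neg x y := S.dObj x ⟶ y
  compNP x y z := hcompFunctor (S.dObj x) y z
  compPN x y z := (S.dFunctor x y).prod (𝟭 (S.dObj y ⟶ z)) ⋙ hcompFunctor _ _ _
  compNN x y z := (S.dFunctor (S.dObj x) y).prod (𝟭 (S.dObj y ⟶ z)) ⋙ hcompFunctor _ _ _ ⋙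
    precompFunctor (S.yApp x) z

/-- Most of the laws are associativity and functoriality of (-)°. When two contravariant factors
follow a covariant φ : a → b, naturality of y gives y_a·φ°° = φ·y_b. For three contravariant
factors, (y_a·φ°·γ)°·θ = (y_a)°·φ°°·γ°·θ; only here is (y_a)° = y_{a°} needed, after which
naturality moves y past φ. -/
theorem contraData_lawful : S.contraData.Lawful := by
  apply ContravarianceData.Lawful.ofCell
  · intro x y (φ : Cell (S.dObj x ⟶ y))
    change (S.dCell (Cell.one x)).comp φ = φ
    rw [dCell_one, Cell.one_comp]
  · intro x y φ
    exact Cell.comp_one (A := A) φ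
  · intro a b c d φ γ (θ : Cell (S.dObj c ⟶ d))
    change (S.dCell (φ.comp γ)).comp θ = (S.dCell φ).comp ((S.dCell γ).comp θ)
    rw [dCell_comp, Cell.assoc]
  · intro a b c d φ (γ : Cell (S.dObj b ⟶ c)) θ
    exact Cell.assoc (S.dCell φ) γ θ
  · intro a b c d (φ : Cell (S.dObj a ⟶ b)) γ θ
    exact Cell.assoc φ γ θ
  · intro a b c d φ (γ : Cell (S.dObj b ⟶ c)) (θ : Cell (S.dObj c ⟶ d))
    change (S.yCell a).comp ((S.dCell ((S.dCell φ).comp γ)).comp θ) =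
      φ.comp ((S.yCell b).comp ((S.dCell γ).comp θ))
    rw [dCell_comp, Cell.assoc, yCell_dCell_dCell_comp]
  · intro a b c d (φ : Cell (S.dObj a ⟶ b)) γ (θ : Cell (S.dObj c ⟶ d))
    change (S.yCell a).comp ((S.dCell (φ.comp γ)).comp θ) =
      (S.yCell a).comp ((S.dCell φ).comp ((S.dCell γ).comp θ))
    rw [dCell_comp, Cell.assoc]
  · intro a b c d (φ : Cell (S.dObj a ⟶ b)) (γ : Cell (S.dObj b ⟶ c)) θ
    change ((S.yCell a).comp ((S.dCell φ).comp γ)).comp θ =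
      (S.yCell a).comp ((S.dCell φ).comp (γ.comp θ))
    rw [Cell.assoc, Cell.assoc]
  · intro a b c d (φ : Cell (S.dObj a ⟶ b)) (γ : Cell (S.dObj b ⟶ c))
      (θ : Cell (S.dObj c ⟶ d))
    change (S.dCell ((S.yCell a).comp ((S.dCell φ).comp γ))).comp θ =
      φ.comp ((S.yCell b).comp ((S.dCell γ).comp θ))
    rw [dCell_comp, dCell_comp, dCell_yCell, Cell.assoc, Cell.assoc, yCell_dCell_dCell_comp]

/-- The contravariance structure given by a strong duality involution. -/
def contra : Contravariance A where
  toContravarianceData := S.contraData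
  lawful := S.contraData_lawful

/-- The contravariant morphism `x ⟶ x°` given by the identity of `x°`. -/
def chi (x : A) : S.contra.Neg x (S.dObj x) := 𝟙 (S.dObj x)

theorem exists_yApp_inverse (x : A) : ∃ g : S.dObj (S.dObj x) ⟶ x,
    S.yApp x ≫ g = 𝟙 x ∧ g ≫ S.yApp x = 𝟙 (S.dObj (S.dObj x)) := S.y.exists_app_inv x

theorem yApp_dObj (x : A) : S.yApp (S.dObj x) = S.dMap (S.yApp x) := S.zeta x

/-- A one-sided inverse g suffices: the other composite is y_{x°}·g° = (y_x)°·g° = (y_x·g)° = 1. -/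
theorem chi_isInverse {x : A} {g : S.dObj (S.dObj x) ⟶ x} (h : S.yApp x ≫ g = 𝟙 x) :
    S.contra.IsInverse (S.chi x) g where
  hom_inv := by
    change S.yApp x ≫ S.dMap (𝟙 (S.dObj x)) ≫ g = 𝟙 x
    rw [S.dMap_id, Strict.id_comp, h]
  inv_hom := by
    change S.yApp (S.dObj x) ≫ S.dMap g ≫ 𝟙 (S.dObj x) = 𝟙 (S.dObj x)
    rw [Strict.comp_id, yApp_dObj, ← S.dMap_comp, h, S.dMap_id]

theorem contra_hasOpposites : S.contra.HasOpposites := fun x => by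
  obtain ⟨g, h, -⟩ := S.exists_yApp_inverse x
  exact ⟨S.dObj x, S.chi x, (S.chi_isInverse h).isOpposite⟩

end StrongDualityInvolution

namespace DualityTwoCat

/-- The 2-category with contravariance given by a 2-category with a strong duality involution. -/
def toContra (A : DualityTwoCat.{w, v, u}) : ContraTwoCat.{w, v, u} where
  carrier := A.carrier
  contra := A.inv.contra

end DualityTwoCat

namespace DualityFunctor

variable {A B : DualityTwoCat.{w, v, u}} (F : DualityFunctor A B)

/-- The identity cell of `i_x`. -/
def iCell (x : A.carrier) :
    Cell (B.inv.dObj (F.toFunctor.obj x) ⟶ F.toFunctor.obj (A.inv.dObj x)) :=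
  Cell.of (F.iApp x)

theorem iCell_naturality {x y : A.carrier} (φ : Cell (x ⟶ y)) :
    (B.inv.dCell (cellMap F.toFunctor φ)).comp (F.iCell y) =
      (F.iCell x).comp (cellMap F.toFunctor (A.inv.dCell φ)) :=
  F.i.cell_naturality φ.toCo

theorem theta_cell (x : A.carrier) :
    (B.inv.yCell (F.toFunctor.obj x)).comp ((B.inv.dCell (F.iCell x)).comp
      (F.iCell (A.inv.dObj x))) = cellMap F.toFunctor (A.inv.yCell x) := by
  rw [iCell, iCell, B.inv.dCell_of, StrongDualityInvolution.yCell, StrongDualityInvolution.yCell,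
    cell_of, ← F.theta', Cell.of_comp, Cell.of_comp]

/-- The action of a duality 2-functor on contravariant morphisms. -/
def negFunctor (x y : A.carrier) :
    (A.inv.dObj x ⟶ y) ⥤ (B.inv.dObj (F.toFunctor.obj x) ⟶ F.toFunctor.obj y) :=
  F.toFunctor.mapFunctor (A.inv.dObj x) y ⋙ precompFunctor (F.iApp x) (F.toFunctor.obj y)

/-- This is preservation of the composite of two contravariant morphisms. The axiom `theta` expands
F(y_x) as y_{Fx}·(i_x)°·i_{x°}, and naturality of i replaces i_{x°}·F(φ°) by (Fφ)°·i_y. -/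
theorem cellMap_yCell_dCell {x y z : A.carrier} (φ : Cell (A.inv.dObj x ⟶ y))
    (γ : Cell (A.inv.dObj y ⟶ z)) :
    cellMap F.toFunctor ((A.inv.yCell x).comp ((A.inv.dCell φ).comp γ)) =
      (B.inv.yCell (F.toFunctor.obj x)).comp
        ((B.inv.dCell ((F.iCell x).comp (cellMap F.toFunctor φ))).comp
          ((F.iCell y).comp (cellMap F.toFunctor γ))) := by
  rw [B.inv.dCell_comp, cell_comp, cell_comp, ← F.theta_cell]
  simp only [Cell.assoc]
  rw [← Cell.assoc (B.inv.dCell (cellMap F.toFunctor φ)), F.iCell_naturality, Cell.assoc]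

theorem iCell_cellMap_dCell {x y z : A.carrier} (φ : Cell (x ⟶ y))
    (γ : Cell (A.inv.dObj y ⟶ z)) :
    (F.iCell x).comp (cellMap F.toFunctor ((A.inv.dCell φ).comp γ)) =
      (B.inv.dCell (cellMap F.toFunctor φ)).comp
        ((F.iCell y).comp (cellMap F.toFunctor γ)) := by
  rw [cell_comp, ← Cell.assoc, ← F.iCell_naturality, Cell.assoc]

/-- The 2-functor preserving contravariance given by a duality 2-functor. -/
def toContra : ContraFunctor A.toContra B.toContra :=
  contraFunctorOfCell (A := A.toContra) (B := B.toContra) F.toFunctor F.negFunctor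
    (fun φ γ => F.cellMap_yCell_dCell φ γ)
    (fun φ γ => (congrArg (F.iCell _).comp (cell_comp F.toFunctor φ γ)).trans
      (Cell.assoc (F.iCell _) (cellMap F.toFunctor φ) (cellMap F.toFunctor γ)).symm)
    (fun φ γ => F.iCell_cellMap_dCell φ γ)

end DualityFunctor

namespace DualityNatTrans

variable {A B : DualityTwoCat.{w, v, u}} {F G : DualityFunctor A B}

/-- Naturality moves α_y to the left across Fφ, where it becomes α_{x°}; there the compatibility of
α with i applies. -/
theorem cell_compat (α : DualityNatTrans F G) {x y : A.carrier} (φ : Cell (A.inv.dObj x ⟶ y)) :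
    ((F.iCell x).comp (cellMap F.toFunctor φ)).comp (Cell.of (α.app y)) =
      (B.inv.dCell (Cell.of (α.app x))).comp ((G.iCell x).comp (cellMap G.toFunctor φ)) := by
  rw [Cell.assoc, α.cell_naturality, B.inv.dCell_of, DualityFunctor.iCell, DualityFunctor.iCell,
    ← Cell.assoc, ← Cell.assoc, ← Cell.of_comp, ← Cell.of_comp, α.compat']

/-- The 2-natural transformation respecting contravariance given by a duality 2-natural
transformation. -/
def toContra (α : DualityNatTrans F G) : ContraNatTrans F.toContra G.toContra :=
  contraNatTransOfCell α.toTwoNatTrans fun φ => α.cell_compat φ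

end DualityNatTrans

namespace DualityTwoCat

variable {A B C : DualityTwoCat.{w, v, u}}

theorem idFunctor_toContra (A : DualityTwoCat.{w, v, u}) :
    (idFunctor A).toContra = ContraTwoCat.idFunctor A.toContra :=
  ContraFunctor.ext rfl fun _ _ => heq_of_eq <| functor_ext_cell fun φ => Cell.one_comp φ

theorem iCell_compFunctor (F : DualityFunctor A B) (G : DualityFunctor B C) {x y : A.carrier}
    (φ : Cell (A.inv.dObj x ⟶ y)) :
    (Cell.of (G.iApp (F.toFunctor.obj x) ≫ G.toFunctor.map (F.iApp x))).comp
      (cellMap G.toFunctor (cellMap F.toFunctor φ)) =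
      (G.iCell (F.toFunctor.obj x)).comp (cellMap G.toFunctor
        ((F.iCell x).comp (cellMap F.toFunctor φ))) := by
  rw [cell_comp, Cell.of_comp, Cell.assoc, DualityFunctor.iCell, DualityFunctor.iCell, cell_of]

theorem compFunctor_toContra (F : DualityFunctor A B) (G : DualityFunctor B C) :
    (compFunctor F G).toContra = ContraTwoCat.compFunctor F.toContra G.toContra :=
  ContraFunctor.ext rfl fun _ _ => heq_of_eq <| functor_ext_cell fun φ =>
    iCell_compFunctor F G φ

end DualityTwoCat

/-! ### From contravariance to duality involutions -/

namespace Contravariance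

variable {A : Type u} [Bicategory.{w, v} A]

/-- A choice, for every object, of an opposite with mutually inverse contravariant morphisms. -/
structure OppositeChoice (K : Contravariance A) where
  obj : A → A
  chi (x : A) : K.Neg x (obj x)
  inv (x : A) : K.Neg (obj x) x
  isInverse (x : A) : K.IsInverse (chi x) (inv x)

/-- If every object has a strict opposite, then opposites can be chosen. -/
noncomputable def oppositeChoice [Strict A] {K : Contravariance A} (h : K.HasOpposites) :
    K.OppositeChoice where
  obj x := (h x).choose
  chi x := (h x).choose_spec.choose
  inv x := (exists_isInverse _ (h x).choose_spec.choose_spec).choose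
  isInverse x := (exists_isInverse _ (h x).choose_spec.choose_spec).choose_spec

namespace OppositeChoice

variable {K : Contravariance A} (O : K.OppositeChoice)

/-- The identity cell of the chosen contravariant morphism `x ⟶ x°`. -/
def chiC (x : A) : Cell (K.Neg x (O.obj x)) := Cell.of (O.chi x)

/-- The identity cell of the chosen contravariant morphism `x° ⟶ x`. -/
def invC (x : A) : Cell (K.Neg (O.obj x) x) := Cell.of (O.inv x)

@[simp]
theorem chiC_invC (x : A) : K.nnC (O.chiC x) (O.invC x) = Cell.one x := (O.isInverse x).nnC

@[simp]
theorem invC_chiC (x : A) : K.nnC (O.invC x) (O.chiC x) = Cell.one (O.obj x) :=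
  (O.isInverse x).symm.nnC

section Cancel

variable [Strict A] {x y : A}

@[simp]
theorem chiC_invC_npC (φ : Cell (x ⟶ y)) : K.nnC (O.chiC x) (K.npC (O.invC x) φ) = φ :=
  (O.isInverse x).nnC_npC φ

@[simp]
theorem invC_chiC_npC (φ : Cell (O.obj x ⟶ y)) : K.nnC (O.invC x) (K.npC (O.chiC x) φ) = φ :=
  (O.isInverse x).symm.nnC_npC φ

@[simp]
theorem chiC_invC_nnC (φ : Cell (K.Neg x y)) : K.npC (O.chiC x) (K.nnC (O.invC x) φ) = φ :=
  (O.isInverse x).npC_nnC φ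

@[simp]
theorem invC_chiC_nnC (φ : Cell (K.Neg (O.obj x) y)) :
    K.npC (O.invC x) (K.nnC (O.chiC x) φ) = φ :=
  (O.isInverse x).symm.npC_nnC φ

end Cancel

/-- The functor `f ↦ f°` on hom-categories: conjugation with the contravariant isomorphisms from
objects to their opposites. -/
def conjFunctor (x y : A) : (x ⟶ y)ᵒᵖ ⥤ (O.obj x ⟶ O.obj y) :=
  Prod.sectL (x ⟶ y)ᵒᵖ (O.chi y) ⋙ K.compPN x y (O.obj y) ⋙ K.preNN (O.inv x) (O.obj y)

/-- The action of `conjFunctor` on cells. -/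
def conj {x y : A} (φ : Cell (x ⟶ y)) : Cell (O.obj x ⟶ O.obj y) :=
  K.nnC (O.invC x) (K.pnC φ (O.chiC y))

/-- The 1-cell `f° : x° ⟶ y°`. -/
def conjMap {x y : A} (f : x ⟶ y) : O.obj x ⟶ O.obj y := (O.conjFunctor x y).obj (op f)

theorem of_conjMap {x y : A} (f : x ⟶ y) : Cell.of (O.conjMap f) = O.conj (Cell.of f) :=
  (mapCell_of (O.conjFunctor x y) (op f)).symm

theorem conj_one (x : A) : O.conj (Cell.one x) = Cell.one (O.obj x) := by
  simp [conj]

variable [Strict A]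

/-- The middle pair in (χ_x⁻¹·φ·χ_y)·(χ_y⁻¹·γ·χ_z) cancels. -/
theorem conj_comp {x y z : A} (φ : Cell (x ⟶ y)) (γ : Cell (y ⟶ z)) :
    O.conj (φ.comp γ) = (O.conj φ).comp (O.conj γ) := by
  simp [conj]

/-- The 2-functor `(-)°` given by a choice of opposites. -/
def dual : StrictPseudofunctor (Co A) A :=
  strictOfCell (fun x => O.obj x.unco) (fun x y => O.conjFunctor x.unco y.unco)
    (fun x => O.conj_one x.unco) (fun φ γ =>
      (congrArg O.conj (Cell.ofCo_comp φ γ)).trans (O.conj_comp φ.ofCo γ.ofCo))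

/-- The isomorphism from `x` to `x°°`. -/
def yApp (x : A) : x ⟶ O.obj (O.obj x) := K.nn (O.chi x) (O.chi (O.obj x))

theorem of_yApp (x : A) : Cell.of (O.yApp x) = K.nnC (O.chiC x) (O.chiC (O.obj x)) :=
  (K.nnC_of _ _).symm

/-- Since φ°° = χ_{x°}⁻¹·(χ_x⁻¹·φ·χ_y)·χ_{y°}, the factor y_x = χ_x·χ_{x°} cancels its left end and
leaves φ·χ_y·χ_{y°}. -/
theorem yApp_naturality {x y : A} (φ : Cell (x ⟶ y)) :
    φ.comp (Cell.of (O.yApp y)) = (Cell.of (O.yApp x)).comp (O.conj (O.conj φ)) := by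
  simp [conj, of_yApp]

theorem exists_yApp_inverse (x : A) : ∃ g : O.obj (O.obj x) ⟶ x,
    O.yApp x ≫ g = 𝟙 x ∧ g ≫ O.yApp x = 𝟙 (O.obj (O.obj x)) := by
  refine ⟨K.nn (O.inv (O.obj x)) (O.inv x), Cell.of_injective ?_, Cell.of_injective ?_⟩
  · rw [Cell.of_comp, of_yApp, ← K.nnC_of]
    change (K.nnC _ _).comp (K.nnC (O.invC _) (O.invC _)) = Cell.one _
    simp
  · rw [Cell.of_comp, of_yApp, ← K.nnC_of]
    change (K.nnC (O.invC _) (O.invC _)).comp (K.nnC _ _) = Cell.one _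
    simp

/-- (y_x)° = χ_x⁻¹·(χ_x·χ_{x°})·χ_{x°°} = χ_{x°}·χ_{x°°}, which is y_{x°}. -/
theorem yApp_obj (x : A) : O.yApp (O.obj x) = O.conjMap (O.yApp x) :=
  Cell.of_injective <| by simp [of_conjMap, conj, of_yApp]

/-- The strong duality involution given by a choice of opposites. -/
def involution : StrongDualityInvolution A where
  dual := O.dual
  y := twoNatIsoOfCell O.yApp (fun φ => O.yApp_naturality φ) O.exists_yApp_inverse
  zeta x := O.yApp_obj x

end OppositeChoice

end Contravariance

open Contravariance

namespace ContraTwoCat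

/-- The 2-category with a strong duality involution given by a 2-category with contravariance and
a choice of opposites. -/
def toDuality (A : ContraTwoCat.{w, v, u}) (O : A.contra.OppositeChoice) :
    DualityTwoCat.{w, v, u} where
  carrier := A.carrier
  inv := O.involution

end ContraTwoCat

namespace ContraFunctor

variable {A B : ContraTwoCat.{w, v, u}} (F : ContraFunctor A B) (O : A.contra.OppositeChoice)
  (P : B.contra.OppositeChoice)

@[simp]
theorem chiC_invC (x : A.carrier) :
    B.contra.nnC (F.negCell (O.chiC x)) (F.negCell (O.invC x)) = Cell.one _ := by
  rw [← F.cell_nnC, O.chiC_invC, cell_one]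

@[simp]
theorem invC_chiC (x : A.carrier) :
    B.contra.nnC (F.negCell (O.invC x)) (F.negCell (O.chiC x)) = Cell.one _ := by
  rw [← F.cell_nnC, O.invC_chiC, cell_one]

@[simp]
theorem chiC_invC_nnC {x : A.carrier} {y : B.carrier}
    (φ : Cell (B.contra.Neg (F.toFunctor.obj x) y)) :
    B.contra.npC (F.negCell (O.chiC x)) (B.contra.nnC (F.negCell (O.invC x)) φ) = φ := by
  rw [← B.contra.nnnC, chiC_invC, B.contra.one_pnC]

/-- The isomorphism from `(F x)°` to `F (x°)`. -/
def iApp (x : A.carrier) : P.obj (F.toFunctor.obj x) ⟶ F.toFunctor.obj (O.obj x) :=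
  B.contra.nn (P.inv (F.toFunctor.obj x)) ((F.neg x (O.obj x)).obj (O.chi x))

theorem of_iApp (x : A.carrier) : Cell.of (F.iApp O P x) =
    B.contra.nnC (P.invC (F.toFunctor.obj x)) (F.negCell (O.chiC x)) := by
  rw [iApp, ← B.contra.nnC_of, ← F.negCell_of]
  rfl

/-- After cancelling χ_{Fy} on the left and F(χ_x) on the right, both sides are χ_{Fx}⁻¹·Fφ·F(χ_y).
-/
theorem iApp_naturality {x y : A.carrier} (φ : Cell (x ⟶ y)) :
    (P.conj (cellMap F.toFunctor φ)).comp (Cell.of (F.iApp O P y)) =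
      (Cell.of (F.iApp O P x)).comp (cellMap F.toFunctor (O.conj φ)) := by
  simp [OppositeChoice.conj, of_iApp, cell_nnC, negCell_pnC]

theorem exists_iApp_inverse (x : A.carrier) :
    ∃ g : F.toFunctor.obj (O.obj x) ⟶ P.obj (F.toFunctor.obj x),
      F.iApp O P x ≫ g = 𝟙 _ ∧ g ≫ F.iApp O P x = 𝟙 _ := by
  refine ⟨B.contra.nn ((F.neg (O.obj x) x).obj (O.inv x)) (P.chi (F.toFunctor.obj x)),
    Cell.of_injective ?_, Cell.of_injective ?_⟩
  · rw [Cell.of_comp, of_iApp, ← B.contra.nnC_of, ← F.negCell_of]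
    change (B.contra.nnC _ _).comp (B.contra.nnC (F.negCell (O.invC _)) (P.chiC _)) = Cell.one _
    simp
  · rw [Cell.of_comp, of_iApp, ← B.contra.nnC_of, ← F.negCell_of]
    change (B.contra.nnC (F.negCell (O.invC _)) (P.chiC _)).comp (B.contra.nnC _ _) = Cell.one _
    simp

/-- All the chosen morphisms of `B` cancel in y_{Fx}·(i_x)°·i_{x°}. What remains is
F(χ_x)·F(χ_{x°}), the image of y_x = χ_x·χ_{x°}. -/
theorem iApp_theta (x : A.carrier) :
    P.yApp (F.toFunctor.obj x) ≫ P.conjMap (F.iApp O P x) ≫ F.iApp O P (O.obj x) =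
      F.toFunctor.map (O.yApp x) :=
  Cell.of_injective <| by
    rw [← cell_of]
    simp [Cell.of_comp, OppositeChoice.of_conjMap, OppositeChoice.conj, of_iApp,
      OppositeChoice.of_yApp, cell_nnC]

/-- The duality 2-functor given by a 2-functor preserving contravariance. -/
def toDuality : DualityFunctor (A.toDuality O) (B.toDuality P) where
  toFunctor := F.toFunctor
  i := twoNatIsoOfCell (fun x => F.iApp O P x.unco)
    (fun φ => F.iApp_naturality O P φ.ofCo) (fun x => F.exists_iApp_inverse O P x.unco)
  theta x := F.iApp_theta O P x

end ContraFunctor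

namespace ContraNatTrans

variable {A B : ContraTwoCat.{w, v, u}} {F G : ContraFunctor A B}

/-- This is naturality of α at the contravariant morphism χ_x, precomposed with χ_{Fx}⁻¹. -/
theorem iApp_compat (α : ContraNatTrans F G) (O : A.contra.OppositeChoice)
    (P : B.contra.OppositeChoice) (x : A.carrier) :
    F.iApp O P x ≫ α.app (O.obj x) = P.conjMap (α.app x) ≫ G.iApp O P x :=
  Cell.of_injective <| by
    simp [Cell.of_comp, OppositeChoice.of_conjMap, OppositeChoice.conj, ContraFunctor.of_iApp,
      α.cell_neg_naturality]

/-- The duality 2-natural transformation given by a 2-natural transformation respecting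
contravariance. -/
def toDuality (α : ContraNatTrans F G) (O : A.contra.OppositeChoice)
    (P : B.contra.OppositeChoice) : DualityNatTrans (F.toDuality O P) (G.toDuality O P) where
  toTwoNatTrans := α.toTwoNatTrans
  compat x := α.iApp_compat O P x

end ContraNatTrans

namespace ContraTwoCat

variable {A B C : ContraTwoCat.{w, v, u}}

/-- With the same choice at both ends, i_x is χ_x⁻¹·χ_x = 1. -/
theorem idFunctor_toDuality (A : ContraTwoCat.{w, v, u}) (O : A.contra.OppositeChoice) :
    (idFunctor A).toDuality O O = DualityTwoCat.idFunctor (A.toDuality O) :=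
  DualityFunctor.ext rfl fun x => heq_of_eq (O.isInverse x.unco).inv_hom

/-- In χ_{GFx}⁻¹·G(χ_{Fx})·G(χ_{Fx}⁻¹·F(χ_x)) the choice made in `B` cancels. This is what makes the
passage to involutions preserve composition strictly. -/
theorem iApp_compFunctor (F : ContraFunctor A B) (G : ContraFunctor B C)
    (O : A.contra.OppositeChoice) (P : B.contra.OppositeChoice) (Q : C.contra.OppositeChoice)
    (x : A.carrier) : Cell.of ((compFunctor F G).iApp O Q x) =
      (Cell.of (G.iApp P Q (F.toFunctor.obj x))).comp
        (cellMap G.toFunctor (Cell.of (F.iApp O P x))) := by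
  simp [ContraFunctor.of_iApp, ContraFunctor.cell_nnC]
  rfl

theorem compFunctor_toDuality (F : ContraFunctor A B) (G : ContraFunctor B C)
    (O : A.contra.OppositeChoice) (P : B.contra.OppositeChoice) (Q : C.contra.OppositeChoice) :
    (compFunctor F G).toDuality O Q =
      DualityTwoCat.compFunctor (F.toDuality O P) (G.toDuality P Q) :=
  DualityFunctor.ext rfl fun x => heq_of_eq <| Cell.of_injective <| by
    refine (iApp_compFunctor F G O P Q x.unco).trans ?_
    rw [cell_of, ← Cell.of_comp]
    rfl

end ContraTwoCat

/-! ### The 2-equivalence -/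

/-- Duality 2-natural transformations are determined by their components, so the 2-dimensional
axioms for `contraToDuality` and for the unit reduce to componentwise comparisons. -/
theorem DualityTwoCat.eq_conj {A B : DualityTwoCat.{w, v, u}} {F F' G G' : A ⟶ B}
    (h : F = F') (k : G' = G) (α : F ⟶ G) (β : F' ⟶ G')
    (e : ∀ x : A.carrier, HEq (TwoNatTrans.app (DualityNatTrans.toTwoNatTrans α) x)
      (TwoNatTrans.app (DualityNatTrans.toTwoNatTrans β) x)) :
    α = eqToHom h ≫ β ≫ eqToHom k := by
  subst h k
  rw [eqToHom_refl, eqToHom_refl, Category.id_comp, Category.comp_id]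
  exact DualityNatTrans.ext fun x => eq_of_heq (e x)

namespace ContraTwoCatWithOpposites

theorem eq_conj {A B : ContraTwoCatWithOpposites.{w, v, u}} {F F' G G' : A ⟶ B}
    (h : F = F') (k : G' = G) (α : F ⟶ G) (β : F' ⟶ G')
    (e : ∀ x : A.1.carrier, HEq (TwoNatTrans.app (ContraNatTrans.toTwoNatTrans α.hom) x)
      (TwoNatTrans.app (ContraNatTrans.toTwoNatTrans β.hom) x)) :
    α = eqToHom h ≫ β ≫ eqToHom k := by
  subst h k
  rw [eqToHom_refl, eqToHom_refl, Category.id_comp, Category.comp_id]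
  exact InducedBicategory.hom₂_ext (ContraNatTrans.ext fun x => eq_of_heq (e x))

/-- The chosen opposites of the objects of a 2-category with contravariance. -/
noncomputable def choice (A : ContraTwoCatWithOpposites.{w, v, u}) :
    A.1.contra.OppositeChoice := oppositeChoice A.2

end ContraTwoCatWithOpposites

/-- The 2-functor from 2-categories with strong duality involutions to 2-categories with
contravariance. -/
def dualityToContra : StrictPseudofunctor DualityTwoCat.{w, v, u}
    ContraTwoCatWithOpposites.{w, v, u} :=
  StrictPseudofunctor.mk''
    { obj := fun A => ⟨A.toContra, A.inv.contra_hasOpposites⟩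
      map := fun F => InducedBicategory.mkHom (DualityFunctor.toContra F)
      map₂ := fun α => ⟨DualityNatTrans.toContra α⟩
      map₂_id := fun _ => rfl
      map₂_comp := fun _ _ => rfl
      map_id := fun A => InducedBicategory.hom_ext (DualityTwoCat.idFunctor_toContra A)
      map_comp := fun F G =>
        InducedBicategory.hom_ext (DualityTwoCat.compFunctor_toContra F G)
      map₂_whisker_left := fun _ _ _ _ =>
        ContraTwoCatWithOpposites.eq_conj _ _ _ _ fun _ => HEq.rfl
      map₂_whisker_right := fun _ _ =>
        ContraTwoCatWithOpposites.eq_conj _ _ _ _ fun _ => HEq.rfl }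

/-- The 2-functor from 2-categories with contravariance in which every object has a strict opposite
to 2-categories with strong duality involutions. -/
noncomputable def contraToDuality : StrictPseudofunctor ContraTwoCatWithOpposites.{w, v, u}
    DualityTwoCat.{w, v, u} :=
  StrictPseudofunctor.mk''
    { obj := fun A => A.1.toDuality A.choice
      map := fun {A B} F => ContraFunctor.toDuality F.hom A.choice B.choice
      map₂ := fun {A B _ _} α => ContraNatTrans.toDuality α.hom A.choice B.choice
      map₂_id := fun _ => rfl
      map₂_comp := fun _ _ => rfl
      map_id := fun A => ContraTwoCat.idFunctor_toDuality A.1 A.choice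
      map_comp := fun {A B C} F G =>
        ContraTwoCat.compFunctor_toDuality F.hom G.hom A.choice B.choice C.choice
      map₂_whisker_left := fun _ _ _ _ => DualityTwoCat.eq_conj _ _ _ _ fun _ => HEq.rfl
      map₂_whisker_right := fun _ _ => DualityTwoCat.eq_conj _ _ _ _ fun _ => HEq.rfl }

open Contravariance
/-! ### The unit -/

namespace StrongDualityInvolution

variable {A : Type u} [Bicategory.{w, v} A] [Strict A] (S : StrongDualityInvolution A)

/-- The opposites given by a strong duality involution. -/
noncomputable def choice : S.contra.OppositeChoice where
  obj := S.dObj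
  chi := S.chi
  inv x := (S.exists_yApp_inverse x).choose
  isInverse x := S.chi_isInverse (S.exists_yApp_inverse x).choose_spec.1

theorem chi_naturality {x y : A} (φ : Cell (x ⟶ y)) :
    S.contra.pnC φ (S.choice.chiC y) = S.contra.npC (S.choice.chiC x) (S.dCell φ) :=
  (Cell.comp_one (S.dCell φ)).trans (Cell.one_comp (S.dCell φ)).symm

/-- Because χ_x is the identity of x°, one has φ·χ_y = χ_x·φ°, and χ_x⁻¹·χ_x cancels. With
`choice_yApp`, this shows that conjugation by the canonical χ gives back the original (-)° and y. -/
theorem choice_conj {x y : A} (φ : Cell (x ⟶ y)) : S.choice.conj φ = S.dCell φ :=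
  (congrArg (S.contra.nnC (S.choice.invC x)) (S.chi_naturality φ)).trans
    (S.choice.invC_chiC_npC _)

theorem choice_conjMap {x y : A} (f : x ⟶ y) : S.choice.conjMap f = S.dMap f :=
  Cell.of_injective <| by
    rw [S.choice.of_conjMap, choice_conj, dCell_of]
    rfl

theorem choice_yApp (x : A) : S.choice.yApp x = S.yApp x := by
  change S.yApp x ≫ S.dMap (𝟙 (S.dObj x)) ≫ 𝟙 (S.dObj (S.dObj x)) = S.yApp x
  rw [S.dMap_id, Strict.comp_id, Strict.comp_id]

end StrongDualityInvolution

/-! ### Comparison of two choices of opposites -/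

namespace ContraTwoCat

/-- The isomorphism between two choices of opposites. -/
def compare (A : ContraTwoCat.{w, v, u}) (O P : A.contra.OppositeChoice) (x : A.carrier) :
    P.obj x ⟶ O.obj x := (idFunctor A).iApp O P x

variable (A : ContraTwoCat.{w, v, u}) (O P : A.contra.OppositeChoice)

theorem of_compare (x : A.carrier) :
    Cell.of (A.compare O P x) = A.contra.nnC (P.invC x) (O.chiC x) :=
  (idFunctor A).of_iApp O P x

theorem compare_comp (x : A.carrier) : A.compare O P x ≫ A.compare P O x = 𝟙 (P.obj x) :=
  Cell.of_injective <| by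
    rw [Cell.of_comp, of_compare, of_compare, ← Cell.one]
    simp

/-- A comparison is the structure isomorphism of the identity 2-functor, taken between two different
choices. Its naturality and its `theta` law are therefore instances of the general ones. -/
theorem compare_naturality {x y : A.carrier} (φ : Cell (x ⟶ y)) :
    (P.conj φ).comp (Cell.of (A.compare O P y)) =
      (Cell.of (A.compare O P x)).comp (O.conj φ) :=
  (idFunctor A).iApp_naturality O P φ

theorem compare_theta (x : A.carrier) :
    P.yApp x ≫ P.conjMap (A.compare O P x) ≫ A.compare O P (O.obj x) = O.yApp x :=
  (idFunctor A).iApp_theta O P x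

end ContraTwoCat

/-- Both composites cancel to the inverse from `P'` followed by the image under F of the χ_x from
`O`. This square makes the unit 2-natural. -/
theorem ContraFunctor.compare_comp_iApp {A B : ContraTwoCat.{w, v, u}}
    (F : ContraFunctor A B) (O O' : A.contra.OppositeChoice) (P P' : B.contra.OppositeChoice)
    (x : A.carrier) :
    B.compare P P' (F.toFunctor.obj x) ≫ F.iApp O P x =
      F.iApp O' P' x ≫ F.toFunctor.map (A.compare O O' x) :=
  Cell.of_injective <| by
    rw [Cell.of_comp, Cell.of_comp, ← cell_of]
    simp [ContraTwoCat.of_compare, F.of_iApp, F.cell_nnC]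

namespace DualityTwoCat

variable (A : DualityTwoCat.{w, v, u}) (O : A.inv.contra.OppositeChoice)

/-- The duality 2-functor from a 2-category with a strong duality involution to the one given by
another choice of the same opposites. -/
noncomputable def toChoice : DualityFunctor A (A.toContra.toDuality O) where
  toFunctor := StrictPseudofunctor.id A.carrier
  i := twoNatIsoOfCell (fun x => A.toContra.compare A.inv.choice O x.unco)
    (fun {x _} φ => (A.toContra.compare_naturality A.inv.choice O φ.ofCo).trans
      (congrArg (Cell.of (A.toContra.compare A.inv.choice O x.unco)).comp
        (A.inv.choice_conj φ.ofCo)))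
    (fun x => ⟨A.toContra.compare O A.inv.choice x.unco,
      A.toContra.compare_comp A.inv.choice O x.unco,
      A.toContra.compare_comp O A.inv.choice x.unco⟩)
  theta x := (A.toContra.compare_theta A.inv.choice O x).trans (A.inv.choice_yApp x)

/-- This is `compare_theta` with target choice the canonical one, whose conjugation and y are the
original (-)° and y. -/
theorem ofChoice_theta (x : A.carrier) :
    A.inv.yApp x ≫ A.inv.dMap (A.toContra.compare O A.inv.choice x) ≫
      A.toContra.compare O A.inv.choice (O.obj x) = O.yApp x := by
  have h := A.toContra.compare_theta O A.inv.choice x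
  exact (congrArg₂ (fun f g => f ≫ g ≫ A.toContra.compare O A.inv.choice (O.obj x))
    (A.inv.choice_yApp x) (A.inv.choice_conjMap _)).symm.trans h

/-- The inverse of `toChoice`. -/
noncomputable def ofChoice : DualityFunctor (A.toContra.toDuality O) A where
  toFunctor := StrictPseudofunctor.id A.carrier
  i := twoNatIsoOfCell (fun x => A.toContra.compare O A.inv.choice x.unco)
    (fun {_ y} φ => (congrArg (Cell.comp · (Cell.of (A.toContra.compare O A.inv.choice y.unco)))
        (A.inv.choice_conj φ.ofCo)).symm.trans
      (A.toContra.compare_naturality O A.inv.choice φ.ofCo))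
    (fun x => ⟨A.toContra.compare A.inv.choice O x.unco,
      A.toContra.compare_comp O A.inv.choice x.unco,
      A.toContra.compare_comp A.inv.choice O x.unco⟩)
  theta x := A.ofChoice_theta O x

theorem toChoice_ofChoice : compFunctor (A.toChoice O) (A.ofChoice O) = idFunctor A :=
  DualityFunctor.ext (strictPseudofunctor_ext rfl) fun x => heq_of_eq
    (A.toContra.compare_comp O A.inv.choice x.unco)

theorem ofChoice_toChoice :
    compFunctor (A.ofChoice O) (A.toChoice O) = idFunctor (A.toContra.toDuality O) :=
  DualityFunctor.ext (strictPseudofunctor_ext rfl) fun x => heq_of_eq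
    (A.toContra.compare_comp A.inv.choice O x.unco)

variable {A} {B : DualityTwoCat.{w, v, u}}

theorem negCell_choice (F : DualityFunctor A B) (x : A.carrier) :
    F.toContra.negCell (A.inv.choice.chiC x) =
      B.inv.contra.npC (B.inv.choice.chiC (F.toFunctor.obj x)) (F.iCell x) := by
  refine (congrArg (F.iCell x).comp (cell_one F.toFunctor (A.inv.dObj x))).trans ?_
  exact (Cell.comp_one (F.iCell x)).trans (Cell.one_comp (F.iCell x)).symm

/-- The image of χ_x, an identity, under the contravariant action of F is i_x, that is, χ_{Fx}·i_x.
Precomposing with χ_{Fx}⁻¹ recovers i_x, so no information about F is lost. -/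
theorem toContra_iApp (F : DualityFunctor A B) (x : A.carrier) :
    F.toContra.iApp A.inv.choice B.inv.choice x = F.iApp x :=
  Cell.of_injective <| (F.toContra.of_iApp A.inv.choice B.inv.choice x).trans <|
    (congrArg (B.inv.contra.nnC _) (negCell_choice F x)).trans
      (B.inv.choice.invC_chiC_npC (F.iCell x))

/-- This is the comparison square with the canonical choices on one side, where the reconstructed i
is the original one. It is the only content of `toChoice_naturality`, since the underlying
2-functors agree. -/
theorem compare_iApp (F : DualityFunctor A B) (O : A.inv.contra.OppositeChoice)
    (P : B.inv.contra.OppositeChoice) (x : A.carrier) :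
    B.toContra.compare B.inv.choice P (F.toFunctor.obj x) ≫ F.iApp x =
      F.toContra.iApp O P x ≫ F.toFunctor.map (A.toContra.compare A.inv.choice O x) :=
  (congrArg (B.toContra.compare B.inv.choice P (F.toFunctor.obj x) ≫ ·)
    (toContra_iApp F x)).symm.trans
    (F.toContra.compare_comp_iApp A.inv.choice O B.inv.choice P x)

theorem toChoice_naturality (F : DualityFunctor A B) (O : A.inv.contra.OppositeChoice)
    (P : B.inv.contra.OppositeChoice) :
    compFunctor F (B.toChoice P) = compFunctor (A.toChoice O) (F.toContra.toDuality O P) :=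
  DualityFunctor.ext (strictPseudofunctor_ext rfl) fun x => heq_of_eq (compare_iApp F O P x.unco)

end DualityTwoCat

/-- The unit of the 2-equivalence. -/
noncomputable def unitIso : TwoNatIso (StrictPseudofunctor.id DualityTwoCat.{w, v, u})
    (dualityToContra.comp contraToDuality) where
  -- The opposites chosen for the image of `A` need not be those of its involution, so the unit is a
  -- comparison and not an identity.
  app A := A.toChoice (ContraTwoCatWithOpposites.choice (dualityToContra.obj A))
  naturality F := DualityTwoCat.toChoice_naturality F _ _
  naturality₂ _ := DualityTwoCat.eq_conj _ _ _ _ fun _ => HEq.rfl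
  exists_inv := TwoNatTrans.exists_inv _ fun A =>
    ⟨A.ofChoice _, A.toChoice_ofChoice _, A.ofChoice_toChoice _⟩

/-! ### The counit -/

namespace ContraTwoCat

variable {A : ContraTwoCat.{w, v, u}} (O : A.contra.OppositeChoice)

/-- Precomposition with χ turns the composition rules of an involution, y_x·φ°·γ and φ°·γ, into the
given compositions: expanding y and (-)° leaves only cancelling pairs. `chiC_pnC` is the second
rule, and `invC_nnC` and `invC_pnC` are the same facts for the inverse direction. -/
theorem chiC_nnC {x y z : A.carrier} (φ : Cell (O.obj x ⟶ y)) (γ : Cell (O.obj y ⟶ z)) :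
    (Cell.of (O.yApp x)).comp ((O.conj φ).comp γ) =
      A.contra.nnC (A.contra.npC (O.chiC x) φ) (A.contra.npC (O.chiC y) γ) := by
  simp [OppositeChoice.conj, OppositeChoice.of_yApp]

theorem chiC_pnC {x y z : A.carrier} (φ : Cell (x ⟶ y)) (γ : Cell (O.obj y ⟶ z)) :
    A.contra.npC (O.chiC x) ((O.conj φ).comp γ) =
      A.contra.pnC φ (A.contra.npC (O.chiC y) γ) := by
  simp [OppositeChoice.conj]

theorem invC_nnC {x y z : A.carrier} (φ : Cell (A.contra.Neg x y)) (γ : Cell (A.contra.Neg y z)) :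
    A.contra.nnC φ γ = (Cell.of (O.yApp x)).comp
      ((O.conj (A.contra.nnC (O.invC x) φ)).comp (A.contra.nnC (O.invC y) γ)) := by
  simp [OppositeChoice.conj, OppositeChoice.of_yApp]

theorem invC_pnC {x y z : A.carrier} (φ : Cell (x ⟶ y)) (γ : Cell (A.contra.Neg y z)) :
    A.contra.nnC (O.invC x) (A.contra.pnC φ γ) =
      (O.conj φ).comp (A.contra.nnC (O.invC y) γ) := by
  simp [OppositeChoice.conj]

variable (A)

/-- Contravariant morphisms are covariant morphisms from the opposite. -/
def ofOpposite : ContraFunctor (A.toDuality O).toContra A :=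
  contraFunctorOfCell (A := (A.toDuality O).toContra) (StrictPseudofunctor.id A.carrier)
    (fun x y => A.contra.preNP (O.chi x) y) (fun φ γ => chiC_nnC O φ γ)
    (fun φ γ => (A.contra.nppC (O.chiC _) φ γ).symm) (fun φ γ => chiC_pnC O φ γ)

/-- The inverse of `ofOpposite`. -/
def toOpposite : ContraFunctor A (A.toDuality O).toContra :=
  contraFunctorOfCell (B := (A.toDuality O).toContra) (StrictPseudofunctor.id A.carrier)
    (fun x y => A.contra.preNN (O.inv x) y) (fun φ γ => invC_nnC O φ γ)
    (fun φ γ => (A.contra.nnpC (O.invC _) φ γ).symm) (fun φ γ => invC_pnC O φ γ)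

theorem ofOpposite_toOpposite :
    compFunctor (A.ofOpposite O) (A.toOpposite O) = idFunctor (A.toDuality O).toContra :=
  ContraFunctor.ext (strictPseudofunctor_ext rfl) fun _ _ => heq_of_eq <|
    functor_ext_cell fun φ => O.invC_chiC_npC φ

theorem toOpposite_ofOpposite :
    compFunctor (A.toOpposite O) (A.ofOpposite O) = idFunctor A :=
  ContraFunctor.ext (strictPseudofunctor_ext rfl) fun _ _ => heq_of_eq <|
    functor_ext_cell fun φ => O.chiC_invC_nnC φ

variable {A} {B : ContraTwoCat.{w, v, u}}

/-- The pair χ_{Fx}·χ_{Fx}⁻¹ cancels, leaving F(χ_x)·Fφ. This is naturality of the counit on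
contravariant cells. -/
theorem chiC_iApp (F : ContraFunctor A B) (O : A.contra.OppositeChoice)
    (P : B.contra.OppositeChoice) {x y : A.carrier} (φ : Cell (O.obj x ⟶ y)) :
    B.contra.npC (P.chiC (F.toFunctor.obj x))
      ((Cell.of (F.iApp O P x)).comp (cellMap F.toFunctor φ)) =
      F.negCell (A.contra.npC (O.chiC x) φ) := by
  simp [ContraFunctor.of_iApp, F.negCell_npC]

theorem ofOpposite_naturality (F : ContraFunctor A B) (O : A.contra.OppositeChoice)
    (P : B.contra.OppositeChoice) :
    compFunctor (F.toDuality O P).toContra (B.ofOpposite P) = compFunctor (A.ofOpposite O) F :=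
  ContraFunctor.ext (strictPseudofunctor_ext rfl) fun _ _ => heq_of_eq <|
    functor_ext_cell fun φ => chiC_iApp F O P φ

end ContraTwoCat

/-- The counit of the 2-equivalence. -/
noncomputable def counitIso : TwoNatIso (contraToDuality.comp dualityToContra)
    (StrictPseudofunctor.id ContraTwoCatWithOpposites.{w, v, u}) where
  app A := InducedBicategory.mkHom (A.1.ofOpposite A.choice)
  naturality {A B} F :=
    InducedBicategory.hom_ext (ContraTwoCat.ofOpposite_naturality F.hom A.choice B.choice)
  naturality₂ _ := ContraTwoCatWithOpposites.eq_conj _ _ _ _ fun _ => HEq.rfl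
  exists_inv := TwoNatTrans.exists_inv _ fun A =>
    ⟨InducedBicategory.mkHom (A.1.toOpposite A.choice),
      InducedBicategory.hom_ext (A.1.ofOpposite_toOpposite A.choice),
      InducedBicategory.hom_ext (A.1.toOpposite_ofOpposite A.choice)⟩

/-- The 2-equivalence between 2-categories with strong duality involutions and 2-categories with
contravariance in which every object has a strict opposite. -/
noncomputable def dualityEquivContra : TwoEquivalence DualityTwoCat.{w, v, u}
    ContraTwoCatWithOpposites.{w, v, u} where
  functor := dualityToContra
  inverse := contraToDuality
  unitIso := unitIso
  counitIso := counitIso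

end TwoDuality

theorem mainTheorem3 :
    Nonempty (TwoDuality.TwoEquivalence TwoDuality.DualityTwoCat.{w, v, u}
      TwoDuality.ContraTwoCatWithOpposites.{w, v, u}) :=
  ⟨TwoDuality.dualityEquivContra⟩
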